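/- All random objects below are defined on one probability space $(\Omega,\mathcal F,\mathbb P)$. A Lévy process is a process $Y=(Y_t)_{t\ge 0}$ with $Y_0=0$ a.s., independent and stationary increments, and a.s. right-continuous paths with left limits; a subordinator is a nondecreasing $[0,\infty)$-valued Lévy process. Let $Z=(Z_n)_{n\ge 0}$ be a random walk in $\mathbb R^d$ (that is, $Z_0=0$ and $Z_n=\zeta_1+\dots+\zeta_n$ with $(\zeta_n)_{n\ge1}$ i.i.d.), and let $T=(T_t)_{t\ge0}$ be a nonconstant subordinator independent of $Z$, with drift $b\ge0$ and Lévy measure $\mu$. This means that $\mu$ is a measure on $(0,\infty)$ with $\int_{(0,\infty)}(1\wedge s)\,\mu(ds)<\infty$ and $$\mathbb E e^{-\lambda T_t}=e^{-t\phi(\lambda)},\qquad \phi(\lambda)=b\lambda+\int_{(0,\infty)}(1-e^{-\lambda s})\,\mu(ds),\qquad \lambda>0,\ t\ge0 .$$ Let $q>0$ be such that $\phi(q)=q$. Let $X=(X_n)_{n\ge0}$ be the corresponding discrete subordinate random walk, i.e. $X_0=0$ and $X_n=\xi_1+\dots+\xi_n$ with $(\xi_n)_{n\ge1}$ i.i.d.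 of law $$\mathbb P(\xi_1\in B)=b\,\mathbb P(Z_1\in B)+\sum_{m=1}^\infty\int_{(0,\infty)}\frac{q^{m-1}t^m}{m!}e^{-qt}\,\mu(dt)\ \mathbb P(Z_m\in B),\qquad B\subset\mathbb R^d\ \text{Borel}.$$ Let $N=(N_t)_{t\ge0}$ be a Poisson process with intensity $q$ that is independent of $X$ and independent of the pair $(T,Z)$. Put $$\hat X_t=X_{N_t},\qquad \tilde X_t=Z_{N_{T_t}},\qquad t\ge0 .$$ Then $\hat X$ and $\tilde X$ are compound Poisson processes, i.e. Lévy processes whose characteristic exponent $\psi$, given by $\mathbb E e^{i\vartheta\cdot Y_t}=e^{-t\psi(\vartheta)}$, has the form $\psi(\vartheta)=c\int_{\mathbb R^d}(1-e^{iy\cdot\vartheta})\,\eta(dy)$ with $c>0$ and $\eta$ a finite (possibly zero) measure satisfying $\eta(\{0\})=0$. Moreover they have the same Lévy triplet $(\beta,Q,\nu)$, where the triplet ($\beta\in\mathbb R^d$, $Q$ a positive semidefinite $d\times d$ matrix, $\nu$ a measure with $\nu(\{0\})=0$ and $\int(1\wedge|y|^2)\,\nu(dy)<\infty$) is the one in the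 representation $$\psi(\vartheta)=i\beta\cdot\vartheta+\tfrac12Q\vartheta\cdot\vartheta+\int_{\mathbb R^d\setminus\{0\}}\bigl(1-e^{iy\cdot\vartheta}+iy\cdot\vartheta\,1_{\{|y|\le1\}}\bigr)\,\nu(dy).$$ Consequently $\hat X$ and $\tilde X$ have the same finite-dimensional distributions. -/

import Mathlib

open MeasureTheory ProbabilityTheory Filter Topology
open scoped NNReal ENNReal Nat

noncomputable section

namespace SubordinateRW

/-- A path on `[0, ∞)` is right-continuous with left limits
(at time `0` the left-limit condition is vacuous). -/
def IsRightContLeftLim {E : Type*} [TopologicalSpace E] (f : ℝ≥0 → E) : Prop :=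
  ∀ t : ℝ≥0, ContinuousWithinAt f (Set.Ici t) t ∧ ∃ l : E, Tendsto f (𝓝[<] t) (𝓝 l)

/-- Lévy process: starts at `0`, has independent and stationary increments, and its paths are
almost surely right-continuous with left limits. -/
structure IsLevyProcess {Ω E : Type*} [MeasurableSpace Ω] [NormedAddCommGroup E]
    [MeasurableSpace E] (X : ℝ≥0 → Ω → E) (P : Measure Ω) : Prop where
  aemeasurable : ∀ t, AEMeasurable (X t) P
  zero : ∀ᵐ ω ∂P, X 0 ω = 0
  indep : HasIndepIncrements X P
  stationary : ∀ s t : ℝ≥0,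
    P.map (fun ω ↦ X (s + t) ω - X s ω) = P.map (fun ω ↦ X t ω - X 0 ω)
  paths : ∀ᵐ ω ∂P, IsRightContLeftLim (fun t ↦ X t ω)

/-- Poisson process with intensity `q`: an `ℕ`-valued Lévy process such that `N t` has the Poisson
distribution with parameter `q * t`. -/
structure IsPoissonProcess {Ω : Type*} [MeasurableSpace Ω] (N : ℝ≥0 → Ω → ℕ) (q : ℝ≥0)
    (P : Measure Ω) : Prop where
  levy : IsLevyProcess (fun t ω ↦ (N t ω : ℝ)) P
  law : ∀ t : ℝ≥0, HasLaw (N t) (poissonMeasure (q * t)) P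

/-- Subordinator: a `[0, ∞)`-valued Lévy process with almost surely nondecreasing paths. -/
structure IsSubordinator {Ω : Type*} [MeasurableSpace Ω] (T : ℝ≥0 → Ω → ℝ≥0)
    (P : Measure Ω) : Prop where
  levy : IsLevyProcess (fun t ω ↦ (T t ω : ℝ)) P
  monotone : ∀ᵐ ω ∂P, Monotone (fun t ↦ T t ω)

/-- `φ(λ) = b λ + ∫ (1 - e^{-λ s}) μ(ds)`. -/
def laplaceExponent (b : ℝ) (μ : Measure ℝ) (l : ℝ) : ℝ :=
  b * l + ∫ s, (1 - Real.exp (-l * s)) ∂μ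

/-- `b` is the drift and `μ` the Lévy measure of the subordinator `T`: `b ≥ 0`, `μ` is a measure
carried by `(0, ∞)` that integrates `1 ∧ s`, and `E e^{-λ T_t} = e^{-t φ(λ)}` for all `λ > 0`. -/
structure HasDriftAndLevyMeasure {Ω : Type*} [MeasurableSpace Ω] (T : ℝ≥0 → Ω → ℝ≥0)
    (P : Measure Ω) (b : ℝ) (μ : Measure ℝ) : Prop where
  drift_nonneg : 0 ≤ b
  carrier : μ (Set.Iic 0) = 0
  integrable : ∫⁻ s, ENNReal.ofReal (min 1 s) ∂μ < ∞
  laplace : ∀ (t : ℝ≥0) (l : ℝ), 0 < l →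
    ∫ ω, Real.exp (-l * (T t ω : ℝ)) ∂P = Real.exp (-(t : ℝ) * laplaceExponent b μ l)

/-- `S n = x 0 + ... + x (n - 1)`, with `S 0 = 0`, for independent steps `x k` of law `ρ`. -/
def IsRandomWalkWithStepLaw {Ω E : Type*} [MeasurableSpace Ω] [NormedAddCommGroup E]
    [MeasurableSpace E] (S : ℕ → Ω → E) (ρ : Measure E) (P : Measure Ω) : Prop :=
  ∃ x : ℕ → Ω → E, iIndepFun x P ∧ (∀ k, HasLaw (x k) ρ P) ∧
    ∀ n ω, S n ω = ∑ k ∈ Finset.range n, x k ω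

/-- Random walk started at `0`, with an arbitrary step distribution. -/
def IsRandomWalk {Ω E : Type*} [MeasurableSpace Ω] [NormedAddCommGroup E]
    [MeasurableSpace E] (S : ℕ → Ω → E) (P : Measure Ω) : Prop :=
  ∃ ρ : Measure E, IsRandomWalkWithStepLaw S ρ P

/-- The measure
`B ↦ b P(Z_1 ∈ B) + ∑_{m ≥ 1} (∫ q^{m-1} t^m / m! e^{-q t} μ(dt)) P(Z_m ∈ B)`
(the summation index below is `m - 1`). -/
def discreteSubordinationLaw {Ω E : Type*} [MeasurableSpace Ω] [MeasurableSpace E]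
    (Z : ℕ → Ω → E) (P : Measure Ω) (b : ℝ) (μ : Measure ℝ) (q : ℝ) : Measure E :=
  ENNReal.ofReal b • P.map (Z 1) +
    Measure.sum fun m : ℕ ↦
      (∫⁻ t, ENNReal.ofReal (q ^ m * t ^ (m + 1) / ((m + 1)! : ℝ) * Real.exp (-q * t)) ∂μ) •
        P.map (Z (m + 1))

/-- The characteristic exponent is `ψ`: `E e^{i θ · X_t} = e^{-t ψ(θ)}`. -/
def HasCharExponent {Ω : Type*} [MeasurableSpace Ω] {d : ℕ}
    (X : ℝ≥0 → Ω → EuclideanSpace ℝ (Fin d)) (P : Measure Ω)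
    (ψ : EuclideanSpace ℝ (Fin d) → ℂ) : Prop :=
  ∀ (t : ℝ≥0) (θ : EuclideanSpace ℝ (Fin d)),
    charFun (P.map (X t)) θ = Complex.exp (-((t : ℝ) : ℂ) * ψ θ)

/-- Right-hand side of the Lévy–Khintchine formula,
`i β·θ + ½ Qθ·θ + ∫ (1 - e^{i y·θ} + i y·θ 1_{|y| ≤ 1}) ν(dy)`. -/
def levyKhintchineExponent {d : ℕ} (β : EuclideanSpace ℝ (Fin d))
    (Q : Matrix (Fin d) (Fin d) ℝ) (ν : Measure (EuclideanSpace ℝ (Fin d)))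
    (θ : EuclideanSpace ℝ (Fin d)) : ℂ :=
  Complex.I * (inner ℝ β θ : ℝ)
    + (((1 / 2 : ℝ) * (Q.mulVec θ.ofLp ⬝ᵥ θ.ofLp) : ℝ) : ℂ)
    + ∫ y, (1 - Complex.exp (Complex.I * (inner ℝ y θ : ℝ))
        + Complex.I * ((if ‖y‖ ≤ 1 then inner ℝ y θ else 0 : ℝ) : ℂ)) ∂ν

/-- `(β, Q, ν)` is the Lévy triplet of the Lévy process `X`. -/
structure HasLevyTriplet {Ω : Type*} [MeasurableSpace Ω] {d : ℕ}
    (X : ℝ≥0 → Ω → EuclideanSpace ℝ (Fin d)) (P : Measure Ω) (β : EuclideanSpace ℝ (Fin d))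
    (Q : Matrix (Fin d) (Fin d) ℝ) (ν : Measure (EuclideanSpace ℝ (Fin d))) : Prop where
  levy : IsLevyProcess X P
  posSemidef : Q.PosSemidef
  no_atom_zero : ν {0} = 0
  integrable : ∫⁻ y, ENNReal.ofReal (min 1 (‖y‖ ^ 2)) ∂ν < ∞
  exponent : HasCharExponent X P (levyKhintchineExponent β Q ν)

/-- Compound Poisson process: a Lévy process with characteristic exponent
`c ∫ (1 - e^{i y·θ}) η(dy)`, where `c > 0` and `η` is a finite measure without mass at `0`. -/
def IsCompoundPoissonProcess {Ω : Type*} [MeasurableSpace Ω] {d : ℕ}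
    (X : ℝ≥0 → Ω → EuclideanSpace ℝ (Fin d)) (P : Measure Ω) : Prop :=
  IsLevyProcess X P ∧
    ∃ (c : ℝ) (η : Measure (EuclideanSpace ℝ (Fin d))), 0 < c ∧ IsFiniteMeasure η ∧ η {0} = 0 ∧
      HasCharExponent X P
        (fun θ ↦ c * ∫ y, (1 - Complex.exp (Complex.I * (inner ℝ y θ : ℝ))) ∂η)

end SubordinateRW

end

open SubordinateRW

/-! Both processes are random walks run by an independent integer-valued Lévy clock: $N$ for $X$,
and $N\circ T$ for $Z$. Conditioning on the clock turns the characteristic function into the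
generating function of the clock, evaluated at the characteristic function of one step
(`IsRandomWalkWithStepLaw.charFun_comp`). For $\hat X$ this gives $\exp(-qt(1-\hat\xi))$, where
$\xi$ is the step law of $X$.

For $\tilde X$ and real $z\in(0,1)$, $\mathbb E z^{N_{T_t}}=\mathbb E
e^{-q(1-z)T_t}=e^{-t\phi(q(1-z))}$. Expanding $e^{qzs}$ inside $\phi$ gives
$\phi(q)-\phi(q(1-z))=qG(z)$, with $G(z)=bz+\sum_m c_m z^{m+1}$ the generating function of the
mixture weights (`tsum_jumpWeight_mul_pow`). As $\phi(q)=q$, the exponent is $q(1-G(z))$. A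
characteristic function is complex, while the Laplace transform is known only on $(0,\infty)$; the
identity theorem carries the formula to the closed unit disk (`integral_pow_comp`). Since
$G(\hat\rho)=\hat\xi$ for the step law $\rho$ of $Z$, the two exponents coincide, and the triplet
can be read off from $q$ and $\xi$.

The Lévy property of both processes comes from one sampling principle, for times in $[0,\infty)$ or
$\mathbb N$ (`HasIndepIncrements.comp_clock`, `HasIndepIncrements.map_sub_comp_clock_eq`). Paths are
càdlàg only almost surely, so evaluation at a random time is made measurable by rebuilding the path
from countably many values (`evalGrid`). -/

namespace ProbabilityTheory

/-! ### Independence and conditioning on an independent variable -/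

section Independence

variable {Ω : Type*} {mΩ : MeasurableSpace Ω} {P : Measure Ω}

/-- Blocks of a family of independent random variables are independent. -/
lemma iIndepFun.curry {ι 𝓧 : Type*} [Countable ι] {κ : ι → Type*} [∀ i, Countable (κ i)]
    [MeasurableSpace 𝓧] {X : (i : ι) → κ i → Ω → 𝓧} (mX : ∀ i j, AEMeasurable (X i j) P)
    (h : iIndepFun (fun (p : (i : ι) × κ i) ω ↦ X p.1 p.2 ω) P) :
    iIndepFun (fun i ω j ↦ X i j ω) P := by
  have := h.isProbabilityMeasure
  have : ∀ i j, IsProbabilityMeasure (P.map (X i j)) :=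
    fun i j ↦ Measure.isProbabilityMeasure_map (mX i j)
  have hblock (i : ι) : iIndepFun (X i) P := h.precomp (g := Sigma.mk i) sigma_mk_injective
  have hcomp : (MeasurableEquiv.piCurry fun i (_ : κ i) ↦ 𝓧) ∘
      (fun ω p ↦ X p.1 p.2 ω) = fun ω i j ↦ X i j ω := by
    ext; simp [Sigma.curry]
  rw [iIndepFun_iff_map_fun_eq_infinitePi_map₀' fun i ↦ aemeasurable_pi_lambda _ (mX i), ← hcomp,
    ← AEMeasurable.map_map_of_aemeasurable (by fun_prop)
      (aemeasurable_pi_lambda (fun ω (p : (i : ι) × κ i) ↦ X p.1 p.2 ω) fun p ↦ mX p.1 p.2),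
    (iIndepFun_iff_map_fun_eq_infinitePi_map₀'
      (X := fun (p : (i : ι) × κ i) ω ↦ X p.1 p.2 ω) fun p ↦ mX p.1 p.2).1 h,
    Measure.infinitePi_map_piCurry (fun i j ↦ P.map (X i j))]
  congr with i : 1
  exact ((iIndepFun_iff_map_fun_eq_infinitePi_map₀' (mX i)).1 (hblock i)).symm

lemma iIndepFun.lintegral_prod_eq_prod_lintegral {ι : Type*} [Fintype ι] {X : ι → Ω → ℝ≥0∞}
    (hX : iIndepFun X P) (mX : ∀ i, AEMeasurable (X i) P) :
    ∫⁻ ω, ∏ i, X i ω ∂P = ∏ i, ∫⁻ ω, X i ω ∂P := by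
  have h := lintegral_prod_eq_prod_lintegral_of_indepFun Finset.univ (fun i ↦ (mX i).mk (X i))
    (hX.congr fun i ↦ (mX i).ae_eq_mk) fun i ↦ (mX i).measurable_mk
  rw [Finset.prod_congr rfl fun i _ ↦ lintegral_congr_ae (mX i).ae_eq_mk, ← h]
  refine lintegral_congr_ae ?_
  filter_upwards [ae_all_iff.2 fun i ↦ (mX i).ae_eq_mk] with ω hω
  exact Finset.prod_congr rfl fun i _ ↦ hω i

lemma IndepFun.lintegral_comp_prodMk [IsFiniteMeasure P] {𝒱 σ : Type*} [MeasurableSpace 𝒱]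
    [MeasurableSpace σ] {V : Ω → 𝒱} {C : Ω → σ} (h : IndepFun V C P) (hV : AEMeasurable V P)
    (hC : AEMeasurable C P) {g : 𝒱 → σ → ℝ≥0∞} (hg : Measurable (Function.uncurry g)) :
    ∫⁻ ω, g (V ω) (C ω) ∂P = ∫⁻ ω', ∫⁻ ω, g (V ω) (C ω') ∂P ∂P := by
  have h1 : ∫⁻ ω, g (V ω) (C ω) ∂P
      = ∫⁻ p, Function.uncurry g p ∂(P.map fun ω ↦ (V ω, C ω)) :=
    (lintegral_map' hg.aemeasurable (hV.prodMk hC)).symm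
  rw [h1, (indepFun_iff_map_prod_eq_prod_map_map hV hC).1 h,
    lintegral_prod_symm' _ hg, lintegral_map' hg.lintegral_prod_left'.aemeasurable hC]
  refine lintegral_congr fun ω' ↦ ?_
  exact lintegral_map' hg.of_uncurry_right.aemeasurable hV

lemma IndepFun.integral_comp_prodMk [IsFiniteMeasure P] {𝒱 σ G : Type*} [MeasurableSpace 𝒱]
    [MeasurableSpace σ] [NormedAddCommGroup G] [NormedSpace ℝ G] [MeasurableSpace G] [BorelSpace G]
    [SecondCountableTopology G] [CompleteSpace G]
    {V : Ω → 𝒱} {C : Ω → σ} (h : IndepFun V C P) (hV : AEMeasurable V P)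
    (hC : AEMeasurable C P) {g : 𝒱 → σ → G} (hg : Measurable (Function.uncurry g)) {c : ℝ}
    (hgc : ∀ v s, ‖g v s‖ ≤ c) :
    ∫ ω, g (V ω) (C ω) ∂P = ∫ ω', ∫ ω, g (V ω) (C ω') ∂P ∂P := by
  have h1 : ∫ ω, g (V ω) (C ω) ∂P
      = ∫ p, Function.uncurry g p ∂(P.map fun ω ↦ (V ω, C ω)) :=
    (integral_map (hV.prodMk hC) hg.aestronglyMeasurable).symm
  rw [h1, (indepFun_iff_map_prod_eq_prod_map_map hV hC).1 h, integral_prod_symm,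
    integral_map hC]
  · refine integral_congr_ae (ae_of_all _ fun ω' ↦ ?_)
    exact integral_map hV hg.of_uncurry_right.aestronglyMeasurable
  · exact (hg.stronglyMeasurable.comp_measurable
      measurable_swap).integral_prod_right'.aestronglyMeasurable
  · exact .of_bound hg.aestronglyMeasurable c (ae_of_all _ fun p ↦ hgc p.1 p.2)

/-- The two independences make the joint law a product of three laws, which can be reassociated. -/
lemma IndepFun.prodMk_left_of_prodMk_right [IsProbabilityMeasure P] {α β γ : Type*}
    [MeasurableSpace α] [MeasurableSpace β] [MeasurableSpace γ] {A : Ω → α} {B : Ω → β} {C : Ω → γ}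
    (hA : AEMeasurable A P) (hB : AEMeasurable B P) (hC : AEMeasurable C P)
    (hABC : IndepFun A (fun ω ↦ (B ω, C ω)) P) (hBC : IndepFun B C P) :
    IndepFun (fun ω ↦ (A ω, B ω)) C P := by
  have hAB : IndepFun A B P := hABC.comp measurable_id measurable_fst
  rw [indepFun_iff_map_prod_eq_prod_map_map (hA.prodMk hB) hC,
    (indepFun_iff_map_prod_eq_prod_map_map hA hB).1 hAB]
  rw [indepFun_iff_map_prod_eq_prod_map_map hA (hB.prodMk hC),
    (indepFun_iff_map_prod_eq_prod_map_map hB hC).1 hBC] at hABC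
  have := Measure.isProbabilityMeasure_map hA
  have := Measure.isProbabilityMeasure_map hB
  have := Measure.isProbabilityMeasure_map hC
  rw [← (MeasurableEquiv.prodAssoc).map_measurableEquiv_injective.eq_iff,
    (measurePreserving_prodAssoc _ _ _).map_eq, ← hABC,
    AEMeasurable.map_map_of_aemeasurable (by fun_prop) ((hA.prodMk hB).prodMk hC)]
  rfl

end Independence

/-! ### Increments of random walks -/

section RandomWalk

variable {Ω E : Type*} {mΩ : MeasurableSpace Ω} {P : Measure Ω} [NormedAddCommGroup E]
  [MeasurableSpace E] {S : ℕ → Ω → E} {ρ : Measure E}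

lemma _root_.SubordinateRW.IsRandomWalkWithStepLaw.aemeasurable [MeasurableAdd₂ E]
    (hS : IsRandomWalkWithStepLaw S ρ P) (n : ℕ) : AEMeasurable (S n) P := by
  obtain ⟨x, -, hx, hSx⟩ := hS
  rw [funext (hSx n)]
  exact Finset.aemeasurable_fun_sum _ fun k _ ↦ (hx k).aemeasurable

lemma _root_.SubordinateRW.IsRandomWalkWithStepLaw.hasIndepIncrements [MeasurableAdd₂ E]
    (hS : IsRandomWalkWithStepLaw S ρ P) : HasIndepIncrements S P := by
  obtain ⟨x, hi, hx, hSx⟩ := hS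
  refine .of_nat fun t ht _ ↦ ?_
  -- The blocks of steps between consecutive times are disjoint, because the times are monotone.
  have hinj : Function.Injective
      fun p : (i : ℕ) × Finset.Ico (t i) (t (i + 1)) ↦ (p.2 : ℕ) := by
    rintro ⟨i, k, hk⟩ ⟨j, l, hl⟩ (rfl : k = l)
    rw [Finset.mem_Ico] at hk hl
    obtain rfl : i = j := by
      rcases lt_trichotomy i j with h | h | h
      · have := ht (Nat.succ_le_of_lt h); grind
      · exact h
      · have := ht (Nat.succ_le_of_lt h); grind
    rfl
  have h := iIndepFun.curry (X := fun i (k : Finset.Ico (t i) (t (i + 1))) ω ↦ x k ω)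
    (fun i k ↦ (hx k).aemeasurable) (hi.precomp hinj)
  convert! h.comp (fun i v ↦ ∑ k, v k) fun i ↦ by fun_prop using 3 with i ω
  rw [hSx, hSx, Function.comp_apply, Finset.sum_coe_sort (Finset.Ico (t i) (t (i + 1)))
    (fun k ↦ x k ω), Finset.sum_Ico_eq_sub _ (ht i.le_succ)]

variable [InnerProductSpace ℝ E] [BorelSpace E] [SecondCountableTopology E]

lemma _root_.SubordinateRW.IsRandomWalkWithStepLaw.charFun_increment
    (hS : IsRandomWalkWithStepLaw S ρ P) (m k : ℕ) (θ : E) :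
    charFun (P.map fun ω ↦ S (m + k) ω - S m ω) θ = charFun ρ θ ^ k := by
  obtain ⟨x, hi, hx, hSx⟩ := hS
  have h : (fun ω ↦ S (m + k) ω - S m ω) = fun ω ↦ ∑ j ∈ Finset.range k, x (m + j) ω := by
    ext ω
    simp [hSx, Finset.sum_range_add]
  have hi' : iIndepFun (fun j ω ↦ x (m + j) ω) P := hi.precomp (add_right_injective m)
  rw [h, iIndepFun.charFun_map_fun_finsetSum_eq_prod (fun j _ ↦ (hx _).aemeasurable)
    (hi'.restrict _)]
  simp [(hx _).map_eq]

lemma _root_.SubordinateRW.IsRandomWalkWithStepLaw.charFun_eq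
    (hS : IsRandomWalkWithStepLaw S ρ P) (k : ℕ) (θ : E) :
    charFun (P.map (S k)) θ = charFun ρ θ ^ k := by
  rw [← hS.charFun_increment 0 k θ]
  obtain ⟨x, hi, hx, hSx⟩ := hS
  simp [hSx, funext (hSx k)]

lemma _root_.SubordinateRW.IsRandomWalkWithStepLaw.map_increment [CompleteSpace E]
    [IsProbabilityMeasure P] (hS : IsRandomWalkWithStepLaw S ρ P) {m n : ℕ} (h : m ≤ n) :
    P.map (fun ω ↦ S n ω - S m ω) = P.map (fun ω ↦ S (n - m) ω - S 0 ω) := by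
  refine Measure.ext_of_charFun (funext fun θ ↦ ?_)
  have h1 := hS.charFun_increment m (n - m) θ
  have h2 := hS.charFun_increment 0 (n - m) θ
  rw [Nat.add_sub_cancel' h] at h1
  rw [zero_add] at h2
  rw [h1, h2]

end RandomWalk

/-! ### Sampling at an independent clock -/

section Subordination

variable {Ω : Type*} {mΩ : MeasurableSpace Ω} {P : Measure Ω} [IsProbabilityMeasure P]
  {τ E 𝒱 : Type*} [MeasurableSpace τ] [MeasurableSpace E] [MeasurableSpace 𝒱] [Zero τ]
  [Sub E] [MeasurableSub₂ E] {Y : τ → Ω → E} {V : Ω → 𝒱} {F : 𝒱 → τ → E}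

/-- Here `V` is a random element that determines the path and `F` a jointly measurable evaluation;
measurability in time is then that of the sections of a measurable set. -/
lemma measurable_map_sub_apply
    (hV : AEMeasurable V P) (hF : Measurable (Function.uncurry F))
    (hYF : ∀ᵐ ω ∂P, ∀ t, Y t ω = F (V ω) t) {B : Set E} (hB : MeasurableSet B) :
    Measurable fun t ↦ P.map (fun ω ↦ Y t ω - Y 0 ω) B := by
  have hFm (t : τ) : Measurable fun v ↦ F v t := hF.of_uncurry_right
  have hG : Measurable fun p : 𝒱 × τ ↦ F p.1 p.2 - F p.1 0 :=
    hF.sub ((hFm 0).comp measurable_fst)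
  convert! measurable_measure_prodMk_right (μ := P.map V) (hG hB) using 2 with t
  have h : (fun ω ↦ Y t ω - Y 0 ω) =ᵐ[P] (fun v ↦ F v t - F v 0) ∘ V := by
    filter_upwards [hYF] with ω hω
    simp [hω]
  have hm : Measurable fun v ↦ F v t - F v 0 := (hFm t).sub (hFm 0)
  rw [Measure.map_congr h, ← AEMeasurable.map_map_of_aemeasurable hm.aemeasurable hV]
  exact Measure.map_apply hm hB

variable [Preorder τ] [Sub τ]

/-- The increments of a process with independent and stationary increments, sampled at an
independent monotone tuple of times with independent increments. -/
lemma HasIndepIncrements.measure_iInter_sub_comp (hYi : HasIndepIncrements Y P)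
    (hYs : ∀ s t, s ≤ t → P.map (fun ω ↦ Y t ω - Y s ω) = P.map (fun ω ↦ Y (t - s) ω - Y 0 ω))
    (hV : AEMeasurable V P) (hF : Measurable (Function.uncurry F))
    (hYF : ∀ᵐ ω ∂P, ∀ t, Y t ω = F (V ω) t) {n : ℕ} {C : Fin (n + 1) → Ω → τ}
    (hC : ∀ i, AEMeasurable (C i) P) (hCm : ∀ᵐ ω ∂P, Monotone fun i ↦ C i ω)
    (hΔ : ∀ i : Fin n, AEMeasurable (fun ω ↦ C i.succ ω - C i.castSucc ω) P)
    (hCi : iIndepFun (fun (i : Fin n) ω ↦ C i.succ ω - C i.castSucc ω) P)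
    (hVC : IndepFun V (fun ω i ↦ C i ω) P) {B : Fin n → Set E} (hB : ∀ i, MeasurableSet (B i)) :
    P (⋂ i, (fun ω ↦ Y (C i.succ ω) ω - Y (C i.castSucc ω) ω) ⁻¹' B i) =
      ∏ i, ∫⁻ ω, P.map (fun ω' ↦ Y (C i.succ ω - C i.castSucc ω) ω' - Y 0 ω') (B i) ∂P := by
  have hFm (t : τ) : Measurable fun v ↦ F v t := hF.of_uncurry_right
  have hY (t : τ) : AEMeasurable (Y t) P :=
    ((hFm t).comp_aemeasurable hV).congr (hYF.mono fun ω hω ↦ (hω t).symm)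
  set D : (Fin (n + 1) → τ) → 𝒱 → Fin n → E :=
    fun s v i ↦ F v (s i.succ) - F v (s i.castSucc) with hD
  have hDm : Measurable (Function.uncurry fun v s ↦ D s v) := by
    refine measurable_pi_lambda _ fun i ↦ ?_
    refine Measurable.sub (f := fun p : 𝒱 × (Fin (n + 1) → τ) ↦ F p.1 (p.2 i.succ))
      (g := fun p ↦ F p.1 (p.2 i.castSucc)) ?_ ?_
    · exact hF.comp (measurable_fst.prodMk ((measurable_pi_apply _).comp measurable_snd))
    · exact hF.comp (measurable_fst.prodMk ((measurable_pi_apply _).comp measurable_snd))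
  set A : Set (Fin n → E) := Set.univ.pi B with hA
  have hAm : MeasurableSet A := .univ_pi hB
  set k : Fin n → τ → ℝ≥0∞ := fun i t ↦ P.map (fun ω' ↦ Y t ω' - Y 0 ω') (B i) with hk
  have hkm (i : Fin n) : Measurable (k i) := measurable_map_sub_apply hV hF hYF (hB i)
  have h1 : P (⋂ i, (fun ω ↦ Y (C i.succ ω) ω - Y (C i.castSucc ω) ω) ⁻¹' B i) =
      ∫⁻ ω, A.indicator 1 (D (fun i ↦ C i ω) (V ω)) ∂P := by
    have hm : AEMeasurable (fun ω ↦ D (fun i ↦ C i ω) (V ω)) P :=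
      hDm.comp_aemeasurable (hV.prodMk (aemeasurable_pi_lambda _ hC))
    rw [← lintegral_map' (by measurability) hm, lintegral_indicator_one hAm,
      Measure.map_apply_of_aemeasurable hm hAm]
    refine measure_congr ?_
    filter_upwards [hYF] with ω hω
    refine propext ?_
    change ω ∈ (⋂ i, (fun ω ↦ Y (C i.succ ω) ω - Y (C i.castSucc ω) ω) ⁻¹' B i) ↔
      D (fun i ↦ C i ω) (V ω) ∈ A
    simp [hA, hD, hω]
  -- At frozen times the probability factors, and each factor depends only on one time difference.
  have h2 (s : Fin (n + 1) → τ) (hs : Monotone s) :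
      ∫⁻ ω, A.indicator 1 (D s (V ω)) ∂P = ∏ i, k i (s i.succ - s i.castSucc) := by
    have hm : AEMeasurable (fun ω ↦ D s (V ω)) P :=
      hDm.of_uncurry_right.comp_aemeasurable hV
    rw [← lintegral_map' (by measurability) hm, lintegral_indicator_one hAm,
      Measure.map_apply_of_aemeasurable hm hAm]
    have h3 := (iIndepFun_iff_measure_inter_preimage_eq_mul.1 (hYi n s hs)) Finset.univ
      (sets := B) fun i _ ↦ hB i
    have h4 : ∀ i, P ((fun ω ↦ Y (s i.succ) ω - Y (s i.castSucc) ω) ⁻¹' B i) =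
        k i (s i.succ - s i.castSucc) := fun i ↦ by
      rw [← Measure.map_apply_of_aemeasurable (by fun_prop) (hB i),
        hYs _ _ (hs (Fin.castSucc_le_succ i))]
    rw [Finset.prod_congr rfl fun i _ ↦ h4 i] at h3
    rw [← h3]
    refine measure_congr ?_
    filter_upwards [hYF] with ω hω
    refine propext ?_
    change D s (V ω) ∈ A ↔
      ω ∈ ⋂ i ∈ Finset.univ, (fun ω ↦ Y (s i.succ) ω - Y (s i.castSucc) ω) ⁻¹' B i
    simp [hA, hD, hω]
  -- Freeze the clock by independence. The factors are then functions of the independent clock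
  -- increments, so the expectation of their product splits.
  rw [h1, hVC.lintegral_comp_prodMk (g := fun v s ↦ A.indicator 1 (D s v)) hV
    (aemeasurable_pi_lambda _ hC) ((measurable_one.indicator hAm).comp hDm),
    lintegral_congr_ae (hCm.mono fun ω hω ↦ h2 _ hω)]
  exact (hCi.comp (fun i ↦ k i) hkm).lintegral_prod_eq_prod_lintegral
    fun i ↦ (hkm i).comp_aemeasurable (hΔ i)

/-- The case of a single increment, where independence of the clock increments is void. -/
lemma HasIndepIncrements.map_sub_comp_apply (hYi : HasIndepIncrements Y P)
    (hYs : ∀ s t, s ≤ t → P.map (fun ω ↦ Y t ω - Y s ω) = P.map (fun ω ↦ Y (t - s) ω - Y 0 ω))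
    (hV : AEMeasurable V P) (hF : Measurable (Function.uncurry F))
    (hYF : ∀ᵐ ω ∂P, ∀ t, Y t ω = F (V ω) t) {C₀ C₁ : Ω → τ}
    (hC₀ : AEMeasurable C₀ P) (hC₁ : AEMeasurable C₁ P) (hle : ∀ᵐ ω ∂P, C₀ ω ≤ C₁ ω)
    (hΔ : AEMeasurable (fun ω ↦ C₁ ω - C₀ ω) P)
    (hVC : IndepFun V (fun ω ↦ (C₀ ω, C₁ ω)) P) {B : Set E} (hB : MeasurableSet B) :
    P ((fun ω ↦ Y (C₁ ω) ω - Y (C₀ ω) ω) ⁻¹' B) =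
      ∫⁻ t, P.map (fun ω' ↦ Y t ω' - Y 0 ω') B ∂(P.map fun ω ↦ C₁ ω - C₀ ω) := by
  rw [lintegral_map' (measurable_map_sub_apply hV hF hYF hB).aemeasurable hΔ]
  have h := hYi.measure_iInter_sub_comp hYs hV hF hYF (n := 1) (C := ![C₀, C₁])
    (by simp [Fin.forall_fin_two, hC₀, hC₁])
    (hle.mono fun ω hω ↦ by simpa [Fin.monotone_iff_le_succ] using hω) (by simpa using hΔ)
    .of_subsingleton ?_ (B := fun _ ↦ B) fun _ ↦ hB
  · simpa [Set.iInter_const, Fin.castSucc, Fin.castAdd, Fin.castLE] using h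
  · have hm : Measurable fun p : τ × τ ↦ (![p.1, p.2] : Fin 2 → τ) :=
      measurable_pi_lambda _ (by simp [Fin.forall_fin_two, measurable_fst, measurable_snd])
    convert! hVC.comp measurable_id hm using 1
    ext ω i
    fin_cases i <;> rfl

variable {ι : Type*} [Preorder ι] {C : ι → Ω → τ}

/-- The factors in the joint formula are the marginal probabilities given by the single-increment
formula. -/
lemma HasIndepIncrements.comp_clock (hYi : HasIndepIncrements Y P)
    (hYs : ∀ s t, s ≤ t → P.map (fun ω ↦ Y t ω - Y s ω) = P.map (fun ω ↦ Y (t - s) ω - Y 0 ω))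
    (hV : AEMeasurable V P) (hF : Measurable (Function.uncurry F))
    (hYF : ∀ᵐ ω ∂P, ∀ t, Y t ω = F (V ω) t)
    (hC : ∀ i, AEMeasurable (C i) P) (hCm : ∀ i j, i ≤ j → ∀ᵐ ω ∂P, C i ω ≤ C j ω)
    (hΔ : ∀ i j, AEMeasurable (fun ω ↦ C j ω - C i ω) P) (hCi : HasIndepIncrements C P)
    (hVC : ∀ (n : ℕ) (t : Fin n → ι), IndepFun V (fun ω i ↦ C (t i) ω) P) :
    HasIndepIncrements (fun i ω ↦ Y (C i ω) ω) P := by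
  classical
  intro n t ht
  rw [iIndepFun_iff_measure_inter_preimage_eq_mul]
  intro s B hB
  set D : Fin n → Ω → E :=
    fun i ω ↦ Y (C (t i.succ) ω) ω - Y (C (t i.castSucc) ω) ω with hD
  have key {B' : Fin n → Set E} (hB' : ∀ i, MeasurableSet (B' i)) :
      P (⋂ i, D i ⁻¹' B' i) = ∏ i, P (D i ⁻¹' B' i) := by
    have hVpair (i : Fin n) :
        IndepFun V (fun ω ↦ (C (t i.castSucc) ω, C (t i.succ) ω)) P :=
      (hVC _ t).comp measurable_id
        (by fun_prop : Measurable fun c : Fin (n + 1) → τ ↦ (c i.castSucc, c i.succ))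
    rw [Finset.prod_congr rfl fun i _ ↦ hYi.map_sub_comp_apply hYs hV hF hYF
      (hC (t i.castSucc)) (hC (t i.succ)) (hCm _ _ (ht (Fin.castSucc_le_succ i))) (hΔ _ _)
      (hVpair i) (hB' i),
      Finset.prod_congr rfl fun i _ ↦ lintegral_map'
        (measurable_map_sub_apply hV hF hYF (hB' i)).aemeasurable (hΔ (t i.castSucc) (t i.succ))]
    refine hYi.measure_iInter_sub_comp hYs hV hF hYF (C := fun i ↦ C (t i)) (fun i ↦ hC _) ?_
      (fun i ↦ hΔ _ _) (hCi n t ht) (hVC _ t) hB'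
    filter_upwards [ae_all_iff.2 fun i : Fin n ↦ hCm _ _ (ht (Fin.castSucc_le_succ i))] with ω hω
    exact Fin.monotone_iff_le_succ.2 hω
  -- A subfamily is handled by imposing no condition on the other increments.
  have h := key (B' := fun i ↦ if i ∈ s then B i else Set.univ) fun i ↦ by
    split_ifs with hi
    exacts [hB i hi, .univ]
  rw [← Finset.prod_subset (Finset.subset_univ s) (by simp +contextual)] at h
  convert! h using 1
  · congr 1
    ext ω
    simp only [Set.mem_iInter, Set.mem_preimage]
    refine forall_congr' fun i ↦ ?_
    by_cases hi : i ∈ s <;> simp [hi, hD]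
  · exact Finset.prod_congr rfl fun i hi ↦ by simp [hi, hD]

/-- A sampled increment is a mixture whose mixing measure is the law of the clock increment, so only
that law matters. -/
lemma HasIndepIncrements.map_sub_comp_clock_eq (hYi : HasIndepIncrements Y P)
    (hYs : ∀ s t, s ≤ t → P.map (fun ω ↦ Y t ω - Y s ω) = P.map (fun ω ↦ Y (t - s) ω - Y 0 ω))
    (hV : AEMeasurable V P) (hF : Measurable (Function.uncurry F))
    (hYF : ∀ᵐ ω ∂P, ∀ t, Y t ω = F (V ω) t)
    (hC : ∀ i, AEMeasurable (C i) P) (hCm : ∀ i j, i ≤ j → ∀ᵐ ω ∂P, C i ω ≤ C j ω)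
    (hΔ : ∀ i j, AEMeasurable (fun ω ↦ C j ω - C i ω) P)
    (hVC : ∀ (n : ℕ) (t : Fin n → ι), IndepFun V (fun ω i ↦ C (t i) ω) P)
    {i j k l : ι} (hij : i ≤ j) (hkl : k ≤ l)
    (h : P.map (fun ω ↦ C j ω - C i ω) = P.map (fun ω ↦ C l ω - C k ω)) :
    P.map (fun ω ↦ Y (C j ω) ω - Y (C i ω) ω) = P.map (fun ω ↦ Y (C l ω) ω - Y (C k ω) ω) := by
  have hm (i : ι) : AEMeasurable (fun ω ↦ Y (C i ω) ω) P :=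
    (hF.comp_aemeasurable (hV.prodMk (hC i))).congr (hYF.mono fun ω hω ↦ (hω _).symm)
  have hd (i j : ι) : AEMeasurable (fun ω ↦ Y (C j ω) ω - Y (C i ω) ω) P := (hm j).sub (hm i)
  have hpair (i j : ι) : IndepFun V (fun ω ↦ (C i ω, C j ω)) P :=
    (hVC 2 ![i, j]).comp measurable_id (by fun_prop : Measurable fun c : Fin 2 → τ ↦ (c 0, c 1))
  ext B hB
  rw [Measure.map_apply_of_aemeasurable (hd i j) hB,
    Measure.map_apply_of_aemeasurable (hd k l) hB]
  exact (hYi.map_sub_comp_apply hYs hV hF hYF (hC i) (hC j) (hCm _ _ hij) (hΔ _ _)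
    (hpair i j) hB).trans <| h ▸ (hYi.map_sub_comp_apply hYs hV hF hYF (hC k) (hC l) (hCm _ _ hkl)
    (hΔ _ _) (hpair k l) hB).symm

end Subordination
end ProbabilityTheory

namespace SubordinateRW

/-! ### Càdlàg paths and their evaluation from grid values -/

section Paths

variable {E : Type*} [TopologicalSpace E]

lemma IsRightContLeftLim.comp_monotone {f : ℝ≥0 → E} {g : ℝ≥0 → ℝ≥0}
    (hf : IsRightContLeftLim f) (hg : IsRightContLeftLim fun t ↦ (g t : ℝ)) (hmono : Monotone g) :
    IsRightContLeftLim fun t ↦ f (g t) := by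
  intro t
  constructor
  · have hgc : ContinuousWithinAt g (Set.Ici t) t := NNReal.tendsto_coe.1 (hg t).1
    exact (hf (g t)).1.comp hgc fun s hs ↦ hmono hs
  · set l := sSup (g '' Set.Iio t)
    have hl : Tendsto g (𝓝[<] t) (𝓝 l) := hmono.tendsto_nhdsLT t
    have hbdd : BddAbove (g '' Set.Iio t) :=
      ⟨g t, by rintro _ ⟨s, hs, rfl⟩; exact hmono (le_of_lt hs)⟩
    have hle : ∀ s < t, g s ≤ l := fun s hs ↦ le_csSup hbdd ⟨s, hs, rfl⟩
    -- Either `g` reaches its left limit before `t`, and the composition is constant just before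
    -- `t`, or `g` stays strictly below `l` and the left limit of `f` at `l` applies.
    by_cases h : ∃ s < t, g s = l
    · obtain ⟨s, hst, hs⟩ := h
      refine ⟨f l, tendsto_const_nhds.congr' ?_⟩
      filter_upwards [Ioo_mem_nhdsLT hst] with u hu
      rw [le_antisymm (hle u hu.2) (hs ▸ hmono hu.1.le)]
    · push Not at h
      obtain ⟨x, hx⟩ := (hf l).2
      refine ⟨x, hx.comp (tendsto_nhdsWithin_iff.2 ⟨hl, ?_⟩)⟩
      filter_upwards [self_mem_nhdsWithin] with u hu
      exact lt_of_le_of_ne (hle u hu) (h u hu)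

lemma IsRightContLeftLim.comp_natCast {f : ℝ≥0 → ℕ} (hf : IsRightContLeftLim fun t ↦ (f t : ℝ))
    (S : ℕ → E) : IsRightContLeftLim fun t ↦ S (f t) := by
  intro t
  have hS : Continuous S := continuous_of_discreteTopology
  constructor
  · have h : ContinuousWithinAt f (Set.Ici t) t :=
      Nat.isClosedEmbedding_coe_real.isEmbedding.tendsto_nhds_iff.2 (hf t).1
    exact hS.continuousAt.comp_continuousWithinAt h
  · obtain ⟨l, hl⟩ := (hf t).2
    -- At time `0` the left filter is trivial and any limit will do.
    rcases (𝓝[<] t).eq_or_neBot with hbot | _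
    · exact ⟨S 0, hbot ▸ tendsto_bot⟩
    obtain ⟨k, rfl⟩ := Nat.isClosedEmbedding_coe_real.isClosed_range.mem_of_tendsto hl
      (Eventually.of_forall fun s ↦ Set.mem_range_self (f s))
    exact ⟨S k, (hS.tendsto k).comp
      (Nat.isClosedEmbedding_coe_real.isEmbedding.tendsto_nhds_iff.2 hl)⟩

/-- The smallest point of the grid `ℕ / (n + 1)` that is strictly larger than `t`. -/
noncomputable def rightGrid (n : ℕ) (t : ℝ≥0) : ℝ≥0 := (⌊(n + 1) * t⌋₊ + 1 : ℕ) / (n + 1)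

lemma le_rightGrid (n : ℕ) (t : ℝ≥0) : t ≤ rightGrid n t := by
  rw [rightGrid, le_div_iff₀ (by positivity), mul_comm]
  exact_mod_cast (Nat.lt_floor_add_one _).le

lemma rightGrid_le (n : ℕ) (t : ℝ≥0) : rightGrid n t ≤ t + 1 / (n + 1) := by
  have h : (t + 1 / (n + 1)) * (n + 1) = (n + 1) * t + 1 := by field_simp
  rw [rightGrid, div_le_iff₀ (by positivity), h]
  push_cast
  gcongr
  exact Nat.floor_le (by positivity)

lemma tendsto_rightGrid (t : ℝ≥0) : Tendsto (fun n ↦ rightGrid n t) atTop (𝓝[≥] t) := by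
  refine tendsto_nhdsWithin_iff.2 ⟨?_, .of_forall fun n ↦ le_rightGrid n t⟩
  refine tendsto_of_tendsto_of_tendsto_of_le_of_le tendsto_const_nhds ?_
    (fun n ↦ le_rightGrid n t) (fun n ↦ rightGrid_le n t)
  simpa using tendsto_const_nhds.add (tendsto_one_div_add_atTop_nhds_zero_nat (𝕜 := ℝ≥0))

/-- Evaluation at time `t` of a right-continuous path that is known on the grids
`ℕ / (n + 1)`. -/
noncomputable def evalGrid (v : ℕ × ℕ → ℝ) (t : ℝ≥0) : ℝ :=
  limsup (fun n : ℕ ↦ v (n, ⌊(n + 1) * t⌋₊ + 1)) atTop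

/-- The time enters only through an integer index, and a limsup is measurable on all arrays,
convergent or not. -/
lemma measurable_evalGrid : Measurable (Function.uncurry evalGrid) := by
  refine Measurable.limsup fun n ↦ ?_
  have h : Measurable fun p : (ℕ × ℕ → ℝ) × ℕ ↦ p.1 (n, p.2 + 1) :=
    measurable_from_prod_countable_left fun k ↦ measurable_pi_apply (n, k + 1)
  have h' : Measurable fun p : (ℕ × ℕ → ℝ) × ℝ≥0 ↦ (p.1, ⌊((n : ℝ≥0) + 1) * p.2⌋₊) :=
    measurable_fst.prodMk (Nat.measurable_floor.comp (measurable_snd.const_mul _))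
  exact h.comp h'

lemma IsRightContLeftLim.eq_evalGrid {f : ℝ≥0 → ℝ} (hf : IsRightContLeftLim f) (t : ℝ≥0) :
    f t = evalGrid (fun p ↦ f (p.2 / (p.1 + 1))) t :=
  (((hf t).1.tendsto.comp (tendsto_rightGrid t)).limsup_eq).symm

end Paths

/-! ### Lévy processes run by a Lévy clock -/

section Levy

variable {Ω : Type*} {mΩ : MeasurableSpace Ω} {P : Measure Ω}

/-- Clocks are Lévy as real processes, but sampling uses truncated subtraction in `ℝ≥0` or `ℕ`. With
`c` the coercion, `r` is `Real.toNNReal` or the floor, both of which send negative differences to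
`0`. -/
lemma _root_.ProbabilityTheory.HasIndepIncrements.of_comp {ι τ : Type*} [Preorder ι] [Sub τ]
    [MeasurableSpace τ]
    {X : ι → Ω → τ} {c : τ → ℝ} {r : ℝ → τ} (hr : Measurable r)
    (hrc : ∀ a b, r (c a - c b) = a - b) (h : HasIndepIncrements (fun t ω ↦ c (X t ω)) P) :
    HasIndepIncrements X P := by
  intro n t ht
  convert! (h n t ht).comp (fun _ ↦ r) fun _ ↦ hr using 3
  simp [hrc]

lemma IsLevyProcess.map_sub_of_comp {τ : Type*} [Sub τ] [MeasurableSpace τ]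
    {X : ℝ≥0 → Ω → τ} {c : τ → ℝ} {r : ℝ → τ} (hr : Measurable r)
    (hrc : ∀ a b, r (c a - c b) = a - b) (h : IsLevyProcess (fun t ω ↦ c (X t ω)) P) (s t : ℝ≥0) :
    P.map (fun ω ↦ X (s + t) ω - X s ω) = P.map (fun ω ↦ X t ω - X 0 ω) := by
  have hm (s t : ℝ≥0) : AEMeasurable (fun ω ↦ c (X t ω) - c (X s ω)) P :=
    (h.aemeasurable t).sub (h.aemeasurable s)
  have h' := congrArg (Measure.map r) (h.stationary s t)
  rw [AEMeasurable.map_map_of_aemeasurable hr.aemeasurable (hm _ _),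
    AEMeasurable.map_map_of_aemeasurable hr.aemeasurable (hm _ _)] at h'
  convert! h' using 2 <;> ext ω <;> simp [hrc]

lemma toNNReal_coe_sub_coe (a b : ℝ≥0) : ((a : ℝ) - b).toNNReal = a - b := by
  rw [NNReal.sub_def]

lemma floor_cast_sub_cast (a b : ℕ) : ⌊(a : ℝ) - b⌋₊ = a - b := by
  simp

lemma aemeasurable_of_natCast {M : Ω → ℕ} (h : AEMeasurable (fun ω ↦ (M ω : ℝ)) P) :
    AEMeasurable M P := by
  simpa [Function.comp_def] using Nat.measurable_floor.comp_aemeasurable h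

lemma aemeasurable_of_nnrealCoe {M : Ω → ℝ≥0} (h : AEMeasurable (fun ω ↦ (M ω : ℝ)) P) :
    AEMeasurable M P := by
  simpa [Function.comp_def] using measurable_real_toNNReal.comp_aemeasurable h

/-- By stationarity the increment has the law of a nonnegative variable. The exceptional set may
depend on the two times, which suffices for sampling. -/
lemma IsLevyProcess.ae_le {X : ℝ≥0 → Ω → ℝ} (hX : IsLevyProcess X P)
    (hnonneg : ∀ t, ∀ᵐ ω ∂P, 0 ≤ X t ω) {s t : ℝ≥0} (hst : s ≤ t) : ∀ᵐ ω ∂P, X s ω ≤ X t ω := by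
  have hm (s t : ℝ≥0) : AEMeasurable (fun ω ↦ X t ω - X s ω) P :=
    (hX.aemeasurable t).sub (hX.aemeasurable s)
  have h : ∀ᵐ ω ∂P, 0 ≤ X (t - s) ω - X 0 ω := by
    filter_upwards [hnonneg (t - s), hX.zero] with ω h1 h2
    simpa [h2] using h1
  rw [← ae_map_iff (p := fun x : ℝ ↦ 0 ≤ x) (hm _ _) measurableSet_Ici, ← hX.stationary s (t - s),
    add_tsub_cancel_of_le hst, ae_map_iff (hm _ _) measurableSet_Ici] at h
  filter_upwards [h] with ω hω using by simpa using hω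

variable [IsProbabilityMeasure P]

/-- Bochner subordination of a real-valued Lévy process. -/
theorem IsLevyProcess.comp_subordinator {Y : ℝ≥0 → Ω → ℝ} (hY : IsLevyProcess Y P)
    {T : ℝ≥0 → Ω → ℝ≥0} (hT : IsSubordinator T P)
    (hYT : IndepFun (fun ω t ↦ Y t ω) (fun ω t ↦ T t ω) P) :
    IsLevyProcess (fun t ω ↦ Y (T t ω) ω) P := by
  have hTm (t : ℝ≥0) : AEMeasurable (T t) P := aemeasurable_of_nnrealCoe (hT.levy.aemeasurable t)
  have hTle (s t : ℝ≥0) (h : s ≤ t) : ∀ᵐ ω ∂P, T s ω ≤ T t ω :=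
    hT.monotone.mono fun ω hω ↦ hω h
  have hTΔ (s t : ℝ≥0) : AEMeasurable (fun ω ↦ T t ω - T s ω) P := (hTm t).sub (hTm s)
  have hYs (s t : ℝ≥0) (h : s ≤ t) :
      P.map (fun ω ↦ Y t ω - Y s ω) = P.map (fun ω ↦ Y (t - s) ω - Y 0 ω) := by
    rw [← hY.stationary s (t - s), add_tsub_cancel_of_le h]
  have hV : AEMeasurable (fun ω (p : ℕ × ℕ) ↦ Y (p.2 / (p.1 + 1)) ω) P :=
    aemeasurable_pi_lambda _ fun p ↦ hY.aemeasurable _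
  have hYF : ∀ᵐ ω ∂P, ∀ t, Y t ω = evalGrid (fun p ↦ Y (p.2 / (p.1 + 1)) ω) t :=
    hY.paths.mono fun ω hω t ↦ hω.eq_evalGrid t
  have hVT (n : ℕ) (t : Fin n → ℝ≥0) :
      IndepFun (fun ω (p : ℕ × ℕ) ↦ Y (p.2 / (p.1 + 1)) ω) (fun ω i ↦ T (t i) ω) P :=
    hYT.comp (by fun_prop : Measurable fun (y : ℝ≥0 → ℝ) (p : ℕ × ℕ) ↦ y (p.2 / (p.1 + 1)))
      (by fun_prop : Measurable fun (c : ℝ≥0 → ℝ≥0) (i : Fin n) ↦ c (t i))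
  refine ⟨fun t ↦ ?_, ?_, ?_, fun s t ↦ ?_, ?_⟩
  · exact (measurable_evalGrid.comp_aemeasurable (hV.prodMk (hTm t))).congr
      (hYF.mono fun ω hω ↦ (hω _).symm)
  · filter_upwards [hY.zero, hT.levy.zero] with ω h1 h2
    rw [NNReal.coe_eq_zero.1 h2, h1]
  · exact hY.indep.comp_clock hYs hV measurable_evalGrid hYF hTm hTle hTΔ
      (hT.levy.indep.of_comp measurable_real_toNNReal toNNReal_coe_sub_coe) hVT
  · exact hY.indep.map_sub_comp_clock_eq hYs hV measurable_evalGrid hYF hTm hTle hTΔ hVT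
      (le_add_of_nonneg_right zero_le) zero_le
      (hT.levy.map_sub_of_comp measurable_real_toNNReal toNNReal_coe_sub_coe s t)
  · filter_upwards [hY.paths, hT.levy.paths, hT.monotone] with ω h1 h2 h3
    exact h1.comp_monotone h2 h3

/-- A random walk run with an independent integer-valued Lévy process as clock is a Lévy
process. -/
theorem IsRandomWalkWithStepLaw.isLevyProcess_comp {E : Type*} [NormedAddCommGroup E]
    [InnerProductSpace ℝ E] [CompleteSpace E] [MeasurableSpace E] [BorelSpace E]
    [SecondCountableTopology E] {S : ℕ → Ω → E} {ρ : Measure E}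
    (hS : IsRandomWalkWithStepLaw S ρ P) {M : ℝ≥0 → Ω → ℕ}
    (hM : IsLevyProcess (fun t ω ↦ (M t ω : ℝ)) P)
    (hSM : ∀ (n : ℕ) (t : Fin n → ℝ≥0),
      IndepFun (fun ω n ↦ S n ω) (fun ω i ↦ M (t i) ω) P) :
    IsLevyProcess (fun t ω ↦ S (M t ω) ω) P := by
  have hMm (t : ℝ≥0) : AEMeasurable (M t) P := aemeasurable_of_natCast (hM.aemeasurable t)
  have hMle (s t : ℝ≥0) (h : s ≤ t) : ∀ᵐ ω ∂P, M s ω ≤ M t ω := by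
    filter_upwards [hM.ae_le (fun t ↦ ae_of_all _ fun ω ↦ by positivity) h] with ω hω
    exact_mod_cast hω
  have hMΔ (s t : ℝ≥0) : AEMeasurable (fun ω ↦ M t ω - M s ω) P := (hMm t).sub (hMm s)
  have hSs (m n : ℕ) (h : m ≤ n) := hS.map_increment h
  have hV : AEMeasurable (fun ω n ↦ S n ω) P := aemeasurable_pi_lambda _ hS.aemeasurable
  -- Time is countable here, so plain evaluation is jointly measurable and no grid is needed.
  have hF : Measurable (Function.uncurry fun (v : ℕ → E) (n : ℕ) ↦ v n) :=
    measurable_from_prod_countable_left fun k ↦ measurable_pi_apply _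
  have hSF : ∀ᵐ ω ∂P, ∀ n, S n ω = (fun n ↦ S n ω) n := ae_of_all _ fun _ _ ↦ rfl
  have hS0 (ω : Ω) : S 0 ω = 0 := by
    obtain ⟨x, -, -, hSx⟩ := hS
    simp [hSx]
  refine ⟨fun t ↦ ?_, ?_, ?_, fun s t ↦ ?_, ?_⟩
  · exact hF.comp_aemeasurable (hV.prodMk (hMm t))
  · filter_upwards [hM.zero] with ω h1
    rw [Nat.cast_eq_zero.1 h1, hS0]
  · exact hS.hasIndepIncrements.comp_clock hSs hV hF hSF hMm hMle hMΔ
      (hM.indep.of_comp Nat.measurable_floor floor_cast_sub_cast) hSM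
  · exact hS.hasIndepIncrements.map_sub_comp_clock_eq hSs hV hF hSF hMm hMle hMΔ hSM
      (le_add_of_nonneg_right zero_le) zero_le
      (hM.map_sub_of_comp Nat.measurable_floor floor_cast_sub_cast s t)
  · filter_upwards [hM.paths] with ω h1
    exact h1.comp_natCast fun n ↦ S n ω

end Levy

/-! ### Generating functions and analytic continuation -/

section GeneratingFunctions

variable {Ω : Type*} {mΩ : MeasurableSpace Ω} {P : Measure Ω}

lemma integral_pow_of_hasLaw_poissonMeasure {M : Ω → ℕ} {r : ℝ≥0}
    (hM : HasLaw M (poissonMeasure r) P) (w : ℂ) :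
    ∫ ω, w ^ M ω ∂P = Complex.exp (r * (w - 1)) := by
  rw [← integral_map (f := fun n : ℕ ↦ w ^ n) hM.aemeasurable (by fun_prop), hM.map_eq,
    integral_poissonMeasure]
  have h : ∀ n : ℕ, (Real.exp (-r) * r ^ n / (n ! : ℝ)) • w ^ n =
      Complex.exp (-r) * ((r * w) ^ n / (n ! : ℂ)) := fun n ↦ by
    rw [Complex.real_smul]
    push_cast
    ring
  rw [tsum_congr h, tsum_mul_left, ← (NormedSpace.expSeries_div_hasSum_exp (r * w)).tsum_eq.symm,
    ← Complex.exp_eq_exp_ℂ, ← Complex.exp_add]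
  ring_nf

variable [IsProbabilityMeasure P]

lemma IsRandomWalkWithStepLaw.charFun_comp {E : Type*} [NormedAddCommGroup E]
    [InnerProductSpace ℝ E] [MeasurableSpace E] [BorelSpace E]
    [SecondCountableTopology E] {S : ℕ → Ω → E} {ρ : Measure E}
    (hS : IsRandomWalkWithStepLaw S ρ P) {M : Ω → ℕ} (hM : AEMeasurable M P)
    (hSM : IndepFun (fun ω n ↦ S n ω) M P) (θ : E) :
    charFun (P.map fun ω ↦ S (M ω) ω) θ = ∫ ω, charFun ρ θ ^ M ω ∂P := by
  have hV : AEMeasurable (fun ω n ↦ S n ω) P := aemeasurable_pi_lambda _ hS.aemeasurable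
  have hF : Measurable (Function.uncurry fun (v : ℕ → E) (n : ℕ) ↦ v n) :=
    measurable_from_prod_countable_left fun k ↦ measurable_pi_apply _
  have he : Measurable fun x : E ↦ Complex.exp (inner ℝ x θ * Complex.I) := by fun_prop
  have hm : AEMeasurable (fun ω ↦ S (M ω) ω) P := hF.comp_aemeasurable (hV.prodMk hM)
  rw [charFun_apply, integral_map hm he.aestronglyMeasurable]
  refine (hSM.integral_comp_prodMk (g := fun (v : ℕ → E) n ↦
    Complex.exp (inner ℝ (v n) θ * Complex.I)) hV hM (he.comp hF) (c := 1)
    fun v n ↦ (Complex.norm_exp_ofReal_mul_I _).le).trans ?_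
  refine integral_congr_ae (ae_of_all _ fun ω ↦ ?_)
  simp only
  rw [← hS.charFun_eq, charFun_apply, integral_map (hS.aemeasurable _) he.aestronglyMeasurable]

lemma differentiableOn_tsum_mul_pow {a : ℕ → ℂ} (ha : Summable fun n ↦ ‖a n‖) (k : ℕ) :
    DifferentiableOn ℂ (fun w ↦ ∑' n, a n * w ^ (n + k)) (Metric.ball 0 1) := by
  refine Complex.differentiableOn_tsum_of_summable_norm ha (fun n ↦ by fun_prop)
    Metric.isOpen_ball fun n w hw ↦ ?_
  rw [norm_mul, norm_pow]
  exact mul_le_of_le_one_right (norm_nonneg _)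
    (pow_le_one₀ (norm_nonneg _) (mem_ball_zero_iff.1 hw).le)

lemma continuousOn_tsum_mul_pow {a : ℕ → ℂ} (ha : Summable fun n ↦ ‖a n‖) (k : ℕ) :
    ContinuousOn (fun w ↦ ∑' n, a n * w ^ (n + k)) (Metric.closedBall 0 1) := by
  refine continuousOn_tsum (fun n ↦ by fun_prop) ha fun n w hw ↦ ?_
  rw [norm_mul, norm_pow]
  exact mul_le_of_le_one_right (norm_nonneg _)
    (pow_le_one₀ (norm_nonneg _) (mem_closedBall_zero_iff.1 hw))

lemma integral_pow_eq_tsum {M : Ω → ℕ} (hM : AEMeasurable M P) {w : ℂ} (hw : ‖w‖ ≤ 1) :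
    ∫ ω, w ^ M ω ∂P = ∑' n, ((P.map M).real {n} : ℂ) * w ^ n := by
  have := Measure.isProbabilityMeasure_map hM
  rw [← integral_map (f := fun n : ℕ ↦ w ^ n) hM (by fun_prop), integral_countable]
  · simp
  · refine .of_bound (by fun_prop) 1 (ae_of_all _ fun n ↦ ?_)
    rw [norm_pow]
    exact pow_le_one₀ (norm_nonneg _) hw

lemma summable_norm_measureReal_singleton (L : Measure ℕ) [IsFiniteMeasure L] :
    Summable fun n ↦ ‖(L.real {n} : ℂ)‖ := by
  have h : ∑' n, L {n} ≠ ∞ := by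
    rw [← measure_iUnion (by simp [Function.onFun, Pairwise]) fun _ ↦ .singleton _]
    exact measure_ne_top _ _
  simpa [Measure.real, abs_of_nonneg] using ENNReal.summable_toReal h

/-- The identity theorem for functions on the closed unit disk that agree on `(0, 1)`. -/
lemma eqOn_closedBall_of_eqOn_Ioo {f g : ℂ → ℂ}
    (hf : DifferentiableOn ℂ f (Metric.ball 0 1)) (hg : DifferentiableOn ℂ g (Metric.ball 0 1))
    (hfc : ContinuousOn f (Metric.closedBall 0 1)) (hgc : ContinuousOn g (Metric.closedBall 0 1))
    (h : ∀ x : ℝ, 0 < x → x < 1 → f x = g x) : Set.EqOn f g (Metric.closedBall 0 1) := by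
  have hball : Set.EqOn f g (Metric.ball 0 1) := by
    refine (hf.analyticOnNhd Metric.isOpen_ball).eqOn_of_preconnected_of_frequently_eq
      (hg.analyticOnNhd Metric.isOpen_ball) (convex_ball 0 1).isPreconnected
      (z₀ := ((1 / 2 : ℝ) : ℂ)) (by rw [mem_ball_zero_iff, Complex.norm_real]; norm_num) ?_
    have ht : Tendsto (fun x : ℝ ↦ (x : ℂ)) (𝓝[≠] (1 / 2)) (𝓝[≠] ((1 / 2 : ℝ) : ℂ)) := by
      refine tendsto_nhdsWithin_iff.2
        ⟨(Complex.continuous_ofReal.tendsto _).mono_left nhdsWithin_le_nhds, ?_⟩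
      filter_upwards [self_mem_nhdsWithin] with x hx
      simpa only [Set.mem_compl_iff, Set.mem_singleton_iff, Complex.ofReal_inj] using hx
    refine ht.frequently (Eventually.frequently ?_)
    filter_upwards [nhdsWithin_le_nhds (Ioo_mem_nhds (by norm_num : (0 : ℝ) < 1 / 2)
      (by norm_num : (1 / 2 : ℝ) < 1))] with x hx
    exact h x hx.1 hx.2
  -- The boundary is needed because a characteristic function can have modulus one, as at
  -- $\theta=0$.
  refine hball.of_subset_closure hfc hgc Metric.ball_subset_closedBall ?_
  rw [closure_ball _ one_ne_zero]

end GeneratingFunctions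

/-! ### The Laplace exponent and the jump weights -/

section LaplaceExponent

variable {μ : Measure ℝ}

lemma ae_pos_of_carrier (hμ : μ (Set.Iic 0) = 0) : ∀ᵐ s ∂μ, 0 < s := by
  rw [ae_iff]
  simpa [Set.Iic] using hμ

lemma integrable_one_sub_exp (hμ : μ (Set.Iic 0) = 0)
    (hμ1 : ∫⁻ s, ENNReal.ofReal (min 1 s) ∂μ < ∞) {l : ℝ} (hl : 0 ≤ l) :
    Integrable (fun s ↦ 1 - Real.exp (-l * s)) μ := by
  have hmin : Integrable (fun s : ℝ ↦ min 1 s) μ := by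
    refine ⟨by fun_prop, ?_⟩
    rw [hasFiniteIntegral_iff_ofReal]
    · exact hμ1
    · filter_upwards [ae_pos_of_carrier hμ] with s hs
      exact le_min zero_le_one hs.le
  -- For $s>0$, $1-e^{-ls}\le\min(1,ls)\le(1+l)\min(1,s)$.
  refine (hmin.const_mul (1 + l)).mono' (by fun_prop) ?_
  filter_upwards [ae_pos_of_carrier hμ] with s hs
  have h1 : Real.exp (-l * s) ≤ 1 := Real.exp_le_one_iff.2 (by nlinarith)
  have h2 := Real.add_one_le_exp (-l * s)
  have h3 := Real.exp_pos (-l * s)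
  rw [Real.norm_of_nonneg (by linarith)]
  rcases min_cases 1 s with ⟨h, -⟩ | ⟨h, -⟩ <;> rw [h] <;> nlinarith

/-- The weight `∫ q^m t^(m+1) / (m+1)! e^{-q t} μ(dt)` of `P(Z_{m+1} ∈ ·)` in the law of the
steps of a discrete subordinate random walk. -/
noncomputable def jumpWeight (μ : Measure ℝ) (q : ℝ) (m : ℕ) : ℝ≥0∞ :=
  ∫⁻ t, ENNReal.ofReal (q ^ m * t ^ (m + 1) / ((m + 1)! : ℝ) * Real.exp (-q * t)) ∂μ

lemma hasSum_pow_div_factorial_succ (q z t : ℝ) (hq : q ≠ 0) :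
    HasSum (fun m : ℕ ↦ q ^ m * t ^ (m + 1) / ((m + 1)! : ℝ) * Real.exp (-q * t) * z ^ (m + 1))
      (q⁻¹ * (Real.exp (-(q * (1 - z)) * t) - Real.exp (-q * t))) := by
  have h := NormedSpace.expSeries_div_hasSum_exp (q * z * t)
  -- Drop the zeroth term of the series of $e^{qzt}$; the prefactor $q^{-1}$ accounts for $q^m$ in
  -- place of $q^{m+1}$.
  rw [← Real.exp_eq_exp_ℝ, ← hasSum_nat_add_iff' 1] at h
  convert! h.mul_left (q⁻¹ * Real.exp (-q * t)) using 1
  · ext m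
    field_simp
    ring
  · have : Real.exp (-(q * (1 - z)) * t) = Real.exp (-q * t) * Real.exp (q * z * t) := by
      rw [← Real.exp_add]; ring_nf
    rw [this]
    simp
    ring

/-- The generating function of the jump weights in terms of the Laplace exponent. -/
lemma tsum_jumpWeight_mul_pow (hμ : μ (Set.Iic 0) = 0)
    (hμ1 : ∫⁻ s, ENNReal.ofReal (min 1 s) ∂μ < ∞) {b q : ℝ} (hq : 0 < q)
    (hw : ∑' m, jumpWeight μ q m ≠ ∞) {z : ℝ} (hz0 : 0 ≤ z) (hz1 : z ≤ 1) :
    q * (b * z + ∑' m, (jumpWeight μ q m).toReal * z ^ (m + 1)) =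
      laplaceExponent b μ q - laplaceExponent b μ (q * (1 - z)) := by
  set f : ℕ → ℝ → ℝ := fun m t ↦ q ^ m * t ^ (m + 1) / ((m + 1)! : ℝ) * Real.exp (-q * t) with hf
  have hf0 (m : ℕ) : 0 ≤ᵐ[μ] f m := by
    filter_upwards [ae_pos_of_carrier hμ] with t ht
    simp only [hf, Pi.zero_apply]
    positivity
  have hfm (m : ℕ) : AEStronglyMeasurable (f m) μ := by fun_prop
  have hfi (m : ℕ) : Integrable (f m) μ := by
    refine ⟨hfm m, ?_⟩
    rw [hasFiniteIntegral_iff_ofReal (hf0 m)]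
    exact (ENNReal.ne_top_of_tsum_ne_top hw m).lt_top
  have hfe (m : ℕ) : ∫ t, f m t ∂μ = (jumpWeight μ q m).toReal :=
    integral_eq_lintegral_of_nonneg_ae (hf0 m) (hfm m)
  -- The terms are dominated by those at $z=1$, so sum and integral may be exchanged.
  have hsum : Summable fun m ↦ ∫ t, ‖f m t * z ^ (m + 1)‖ ∂μ := by
    refine (ENNReal.summable_toReal hw).of_nonneg_of_le
      (fun m ↦ integral_nonneg fun t ↦ norm_nonneg _) fun m ↦ ?_
    rw [← hfe]
    refine integral_mono_ae ((hfi m).mul_const _).norm (hfi m) ?_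
    filter_upwards [hf0 m] with t ht
    have hzp : z ^ (m + 1) ≤ 1 := pow_le_one₀ hz0 hz1
    have ht' : 0 ≤ f m t := ht
    rw [Real.norm_of_nonneg (by positivity)]
    exact mul_le_of_le_one_right ht hzp
  have h := (hasSum_integral_of_summable_integral_norm (fun m ↦ (hfi m).mul_const _) hsum).tsum_eq
  simp_rw [integral_mul_const, hfe] at h
  have h1 := integrable_one_sub_exp hμ hμ1 hq.le
  have h2 := integrable_one_sub_exp hμ hμ1 (mul_nonneg hq.le (sub_nonneg.2 hz1))
  rw [h, laplaceExponent, laplaceExponent, integral_congr_ae (ae_of_all _ fun t ↦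
    (hasSum_pow_div_factorial_succ q z t hq.ne').tsum_eq), integral_const_mul, mul_add,
    mul_inv_cancel_left₀ hq.ne', add_sub_add_comm, ← integral_sub h1 h2]
  congr 1
  · ring
  · simp

end LaplaceExponent

/-! ### Countable mixtures of laws -/

section Mixture

variable {E : Type*} [MeasurableSpace E] {ρ₀ : Measure E} {ρ : ℕ → Measure E} {c : ℕ → ℝ≥0∞}

lemma tsum_ne_top_of_isFiniteMeasure [∀ m, IsProbabilityMeasure (ρ m)] {a : ℝ≥0∞}
    (h : IsFiniteMeasure (a • ρ₀ + Measure.sum fun m ↦ c m • ρ m)) : ∑' m, c m ≠ ∞ := by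
  have h' := h.measure_univ_lt_top
  rw [Measure.add_apply, Measure.sum_apply _ .univ] at h'
  simpa using (ENNReal.add_lt_top.1 h').2.ne

lemma charFun_smul_add_sum_smul [NormedAddCommGroup E] [InnerProductSpace ℝ E] [BorelSpace E]
    [SecondCountableTopology E] {a : ℝ} (ha : 0 ≤ a)
    (h : IsFiniteMeasure (ENNReal.ofReal a • ρ₀ + Measure.sum fun m ↦ c m • ρ m)) (θ : E) :
    charFun (ENNReal.ofReal a • ρ₀ + Measure.sum fun m ↦ c m • ρ m) θ =
      a * charFun ρ₀ θ + ∑' m, ((c m).toReal : ℂ) * charFun (ρ m) θ := by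
  have hi : Integrable (fun x : E ↦ Complex.exp (inner ℝ x θ * Complex.I))
      (ENNReal.ofReal a • ρ₀ + Measure.sum fun m ↦ c m • ρ m) :=
    .of_bound (by fun_prop) 1 (ae_of_all _ fun x ↦ (Complex.norm_exp_ofReal_mul_I _).le)
  rw [charFun_apply, integral_add_measure hi.left_of_add_measure hi.right_of_add_measure,
    integral_smul_measure, integral_sum_measure hi.right_of_add_measure]
  simp [integral_smul_measure, charFun_apply, ENNReal.toReal_ofReal ha]

end Mixture

/-! ### Finite-dimensional distributions from marginals -/

section FiniteDimensionalDistributions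

variable {Ω E : Type*} {mΩ : MeasurableSpace Ω} {P : Measure Ω} [NormedAddCommGroup E]
  [MeasurableSpace E] [MeasurableSub₂ E]

lemma IsLevyProcess.aemeasurable_sub {X : ℝ≥0 → Ω → E} (hX : IsLevyProcess X P) (s t : ℝ≥0) :
    AEMeasurable (fun ω ↦ X t ω - X s ω) P :=
  (hX.aemeasurable t).sub (hX.aemeasurable s)

/-- The law of the increments of a Lévy process along a monotone tuple of times. -/
lemma IsLevyProcess.map_increments {X : ℝ≥0 → Ω → E} (hX : IsLevyProcess X P) {n : ℕ}
    {t : Fin (n + 1) → ℝ≥0} (ht : Monotone t) :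
    P.map (fun ω (i : Fin n) ↦ X (t i.succ) ω - X (t i.castSucc) ω) =
      Measure.pi fun i ↦ P.map (X (t i.succ - t i.castSucc)) := by
  rw [(hX.indep n t ht).map_fun_eq_pi_map fun i ↦ hX.aemeasurable_sub _ _]
  congr with i : 1
  have h := hX.stationary (t i.castSucc) (t i.succ - t i.castSucc)
  rw [add_tsub_cancel_of_le (ht (Fin.castSucc_le_succ i))] at h
  rw [h]
  refine Measure.map_congr ?_
  filter_upwards [hX.zero] with ω hω
  simp [hω]

/-- Two Lévy processes with the same one-dimensional marginals have the same finite-dimensional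
distributions. -/
theorem IsLevyProcess.map_restrict_eq [MeasurableAdd₂ E] {X Y : ℝ≥0 → Ω → E} (hX : IsLevyProcess X P)
    (hY : IsLevyProcess Y P) (h : ∀ t, P.map (X t) = P.map (Y t)) (I : Finset ℝ≥0) :
    P.map (fun ω ↦ I.restrict fun t ↦ X t ω) = P.map (fun ω ↦ I.restrict fun t ↦ Y t ω) := by
  set n := I.card
  set t : Fin (n + 1) → ℝ≥0 := Fin.cons 0 (I.orderEmbOfFin rfl) with ht
  have htm : Monotone t := by
    intro i j hij
    induction i using Fin.cases with
    | zero => simp [ht]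
    | succ i =>
      induction j using Fin.cases with
      | zero => simp at hij
      | succ j => simpa [ht] using hij
  -- With time `0` prepended, partial sums of the increments recover the values; this map is the
  -- same for both processes.
  set G : (Fin n → E) → I → E :=
    fun x s ↦ ∑ j ∈ Finset.Iic ((I.orderIsoOfFin rfl).symm s), x j with hG
  have hGm : Measurable G := by fun_prop
  have key {W : ℝ≥0 → Ω → E} (hW : IsLevyProcess W P) :
      P.map (fun ω ↦ I.restrict fun t ↦ W t ω) =
        (Measure.pi fun i ↦ P.map (W (t i.succ - t i.castSucc))).map G := by
    rw [← hW.map_increments htm, AEMeasurable.map_map_of_aemeasurable hGm.aemeasurable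
      (aemeasurable_pi_lambda _ fun i ↦ hW.aemeasurable_sub _ _)]
    refine Measure.map_congr ?_
    filter_upwards [hW.zero] with ω hω
    ext s
    rw [Function.comp_apply, hG]
    simp only [Finset.restrict]
    rw [Fin.sum_Iic_sub _ (fun j ↦ W (t j) ω)]
    simp [ht, hω, Finset.orderEmbOfFin]
  rw [key hX, key hY]
  simp_rw [h]

end FiniteDimensionalDistributions

/-! ### Compound Poisson exponents and their triplets -/

section CompoundPoisson

variable {Ω : Type*} {mΩ : MeasurableSpace Ω} {P : Measure Ω} {d : ℕ}
  {X : ℝ≥0 → Ω → EuclideanSpace ℝ (Fin d)} {ξ : Measure (EuclideanSpace ℝ (Fin d))}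

/-- `1 - e^{i y·θ}` integrates to `1 - charFun ξ θ`, and the atom at `0` does not contribute. -/
lemma setIntegral_one_sub_exp [IsProbabilityMeasure ξ] (θ : EuclideanSpace ℝ (Fin d)) :
    ∫ y in {0}ᶜ, (1 - Complex.exp (Complex.I * (inner ℝ y θ : ℝ))) ∂ξ = 1 - charFun ξ θ := by
  rw [setIntegral_eq_integral_of_forall_compl_eq_zero (by simp), integral_sub, charFun_apply]
  · simp [mul_comm]
  · fun_prop
  · refine .of_bound (by fun_prop) 1 (ae_of_all _ fun x ↦ ?_)
    rw [mul_comm]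
    exact (Complex.norm_exp_ofReal_mul_I _).le

lemma isCompoundPoissonProcess_of_hasCharExponent [IsProbabilityMeasure ξ]
    (hX : IsLevyProcess X P) {q : ℝ} (hq : 0 < q)
    (h : HasCharExponent X P fun θ ↦ q * (1 - charFun ξ θ)) : IsCompoundPoissonProcess X P := by
  -- A step may vanish with positive probability, so the atom at `0` is removed; the rate stays `q`.
  refine ⟨hX, q, ξ.restrict {0}ᶜ, hq, inferInstance, by simp, ?_⟩
  simpa only [setIntegral_one_sub_exp] using h

/-- The Lévy triplet of a compound Poisson process of rate `q` with jump law `ξ`. -/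
lemma hasLevyTriplet_of_hasCharExponent [IsProbabilityMeasure ξ]
    (hX : IsLevyProcess X P) {q : ℝ≥0}
    (h : HasCharExponent X P fun θ ↦ q * (1 - charFun ξ θ)) :
    HasLevyTriplet X P (-∫ y in Metric.closedBall 0 1, y ∂(q • ξ.restrict {0}ᶜ)) 0
      (q • ξ.restrict {0}ᶜ) := by
  set ν := q • ξ.restrict {0}ᶜ with hν
  refine ⟨hX, .zero, by simp [hν], ?_, ?_⟩
  · calc ∫⁻ y, ENNReal.ofReal (min 1 (‖y‖ ^ 2)) ∂ν ≤ ∫⁻ _, 1 ∂ν :=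
          lintegral_mono fun y ↦ by simp
      _ < ∞ := by simp
  · convert! h using 2 with θ
    have hexp : Integrable (fun y ↦ 1 - Complex.exp (Complex.I * (inner ℝ y θ : ℝ))) ν := by
      refine .of_bound (by fun_prop) 2 (ae_of_all _ fun x ↦ ?_)
      refine (norm_sub_le _ _).trans ?_
      rw [mul_comm, Complex.norm_exp_ofReal_mul_I]
      norm_num
    have hid : IntegrableOn (fun y : EuclideanSpace ℝ (Fin d) ↦ y) (Metric.closedBall 0 1) ν := by
      refine .of_bound (measure_lt_top _ _) (by fun_prop) 1 ?_
      filter_upwards [ae_restrict_mem Metric.isClosed_closedBall.measurableSet] with y hy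
      simpa using hy
    have hite : (fun y : EuclideanSpace ℝ (Fin d) ↦ (if ‖y‖ ≤ 1 then inner ℝ y θ else 0 : ℝ)) =
        (Metric.closedBall 0 1).indicator fun y ↦ inner ℝ y θ := by
      ext y; simp [Set.indicator]
    have hin : Integrable
        (fun y : EuclideanSpace ℝ (Fin d) ↦ (if ‖y‖ ≤ 1 then inner ℝ y θ else 0 : ℝ)) ν := by
      rw [hite, integrable_indicator_iff Metric.isClosed_closedBall.measurableSet]
      exact hid.inner_const θ
    -- The compensator is linear in `θ`, and the drift is chosen to cancel it.
    have hint : ∫ y, (if ‖y‖ ≤ 1 then inner ℝ y θ else 0 : ℝ) ∂ν =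
        inner ℝ (∫ y in Metric.closedBall 0 1, y ∂ν) θ := by
      rw [hite, integral_indicator Metric.isClosed_closedBall.measurableSet, real_inner_comm,
        ← integral_inner hid]
      simp [real_inner_comm]
    have hinC : Integrable (fun y : EuclideanSpace ℝ (Fin d) ↦
        Complex.I * ((if ‖y‖ ≤ 1 then inner ℝ y θ else 0 : ℝ) : ℂ)) ν :=
      (hin.ofReal (𝕜 := ℂ)).const_mul _
    rw [levyKhintchineExponent, integral_add hexp hinC, integral_const_mul,
      integral_complex_ofReal, hint, hν, integral_smul_nnreal_measure, setIntegral_one_sub_exp, ← hν]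
    simp [NNReal.smul_def]

end CompoundPoisson

/-! ### The clock $N\circ T$ -/

section PoissonSubordination

variable {Ω : Type*} {mΩ : MeasurableSpace Ω} {P : Measure Ω}
  {N : ℝ≥0 → Ω → ℕ} {T : ℝ≥0 → Ω → ℝ≥0} {q : ℝ≥0}

lemma ae_natCast_eq_evalGrid (hN : IsLevyProcess (fun t ω ↦ (N t ω : ℝ)) P) :
    ∀ᵐ ω ∂P, ∀ t, N t ω = ⌊evalGrid (fun p ↦ (N (p.2 / (p.1 + 1)) ω : ℝ)) t⌋₊ := by
  filter_upwards [hN.paths] with ω hω t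
  rw [← hω.eq_evalGrid t, Nat.floor_natCast]

lemma aemeasurable_grid (hN : IsLevyProcess (fun t ω ↦ (N t ω : ℝ)) P) :
    AEMeasurable (fun ω (p : ℕ × ℕ) ↦ (N (p.2 / (p.1 + 1)) ω : ℝ)) P :=
  aemeasurable_pi_lambda _ fun _ ↦ hN.aemeasurable _

lemma measurable_grid : Measurable fun (y : ℝ≥0 → ℕ) (p : ℕ × ℕ) ↦ (y (p.2 / (p.1 + 1)) : ℝ) := by
  fun_prop

variable [IsProbabilityMeasure P]

lemma measurable_floor_evalGrid :
    Measurable fun p : (ℕ × ℕ → ℝ) × ℝ≥0 ↦ ⌊evalGrid p.1 p.2⌋₊ :=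
  Nat.measurable_floor.comp measurable_evalGrid

/-- The generating function of `N_{T_t}` at real arguments. -/
lemma integral_pow_comp_eq_laplace (hN : IsPoissonProcess N q P) (hT : IsSubordinator T P)
    (hNT : IndepFun (fun ω t ↦ N t ω) (fun ω t ↦ T t ω) P) (t : ℝ≥0) {z : ℝ} (hz0 : 0 ≤ z)
    (hz1 : z ≤ 1) :
    ∫ ω, (z : ℂ) ^ N (T t ω) ω ∂P =
      ((∫ ω, Real.exp (-(q * (1 - z)) * (T t ω : ℝ)) ∂P : ℝ) : ℂ) := by
  have hTm : AEMeasurable (T t) P := aemeasurable_of_nnrealCoe (hT.levy.aemeasurable t)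
  have hind : IndepFun (fun ω (p : ℕ × ℕ) ↦ (N (p.2 / (p.1 + 1)) ω : ℝ)) (T t) P :=
    hNT.comp measurable_grid (measurable_pi_apply t)
  set g : (ℕ × ℕ → ℝ) → ℝ≥0 → ℂ := fun v s ↦ (z : ℂ) ^ ⌊evalGrid v s⌋₊ with hg
  have hgm : Measurable (Function.uncurry g) :=
    (measurable_of_countable fun n : ℕ ↦ (z : ℂ) ^ n).comp
      measurable_floor_evalGrid
  have hgb (v s) : ‖g v s‖ ≤ 1 := by
    rw [hg, norm_pow, Complex.norm_real, Real.norm_of_nonneg hz0]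
    exact pow_le_one₀ hz0 hz1
  have hNg : ∀ᵐ ω ∂P, ∀ s, (z : ℂ) ^ N s ω = g (fun p ↦ (N (p.2 / (p.1 + 1)) ω : ℝ)) s :=
    (ae_natCast_eq_evalGrid hN.levy).mono fun ω hω s ↦ by rw [hω s]
  rw [integral_congr_ae (hNg.mono fun ω hω ↦ hω (T t ω)),
    hind.integral_comp_prodMk (aemeasurable_grid hN.levy) hTm hgm hgb, ← integral_complex_ofReal]
  refine integral_congr_ae (ae_of_all _ fun ω' ↦ ?_)
  simp only
  rw [← integral_congr_ae (hNg.mono fun ω hω ↦ hω (T t ω')),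
    integral_pow_of_hasLaw_poissonMeasure (hN.law _)]
  push_cast
  ring_nf

/-- The generating function of `N_{T_t}` on the closed unit disk. -/
lemma integral_pow_comp (hN : IsPoissonProcess N q P) (hT : IsSubordinator T P)
    (hNT : IndepFun (fun ω t ↦ N t ω) (fun ω t ↦ T t ω) P) {b : ℝ} {μ : Measure ℝ}
    (hbμ : HasDriftAndLevyMeasure T P b μ) (hq : 0 < q)
    (hφ : laplaceExponent b μ q = q) (hw : ∑' m, jumpWeight μ q m ≠ ∞) (t : ℝ≥0)
    {w : ℂ} (hw1 : ‖w‖ ≤ 1) :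
    ∫ ω, w ^ N (T t ω) ω ∂P = Complex.exp (-((t : ℝ) : ℂ) *
      (q * (1 - (b * w + ∑' m, ((jumpWeight μ q m).toReal : ℂ) * w ^ (m + 1))))) := by
  have hm : AEMeasurable (fun ω ↦ N (T t ω) ω) P :=
    aemeasurable_of_natCast ((hN.levy.comp_subordinator hT (hNT.comp
      (by fun_prop : Measurable fun (y : ℝ≥0 → ℕ) s ↦ (y s : ℝ)) measurable_id)).aemeasurable t)
  have := Measure.isProbabilityMeasure_map hm
  have hL := summable_norm_measureReal_singleton (P.map fun ω ↦ N (T t ω) ω)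
  have hc : Summable fun m ↦ ‖((jumpWeight μ q m).toReal : ℂ)‖ := by
    simpa using ENNReal.summable_toReal hw
  have hd := differentiableOn_tsum_mul_pow hL 0
  have hd' := continuousOn_tsum_mul_pow hL 0
  simp only [add_zero] at hd hd'
  rw [integral_pow_eq_tsum hm hw1]
  -- For $0<z<1$ the point $q(1-z)$ is positive, so the Laplace transform of $T_t$ is available
  -- there.
  refine eqOn_closedBall_of_eqOn_Ioo (f := fun w ↦ ∑' n,
      ((P.map fun ω ↦ N (T t ω) ω).real {n} : ℂ) * w ^ n) (g := fun w ↦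
      Complex.exp (-((t : ℝ) : ℂ) *
      (q * (1 - (b * w + ∑' m, ((jumpWeight μ q m).toReal : ℂ) * w ^ (m + 1))))))
    hd ?_ hd' ?_ (fun z hz0 hz1 ↦ ?_) (mem_closedBall_zero_iff.2 hw1)
  · have := differentiableOn_tsum_mul_pow hc 1
    fun_prop
  · have := continuousOn_tsum_mul_pow hc 1
    fun_prop
  · have hz : ‖(z : ℂ)‖ ≤ 1 := by
      rw [Complex.norm_real, Real.norm_of_nonneg hz0.le]
      exact hz1.le
    have hg := tsum_jumpWeight_mul_pow hbμ.carrier hbμ.integrable (b := b)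
      (NNReal.coe_pos.2 hq) hw hz0.le hz1.le
    rw [hφ] at hg
    have hl : 0 < (q : ℝ) * (1 - z) := mul_pos (NNReal.coe_pos.2 hq) (sub_pos.2 hz1)
    rw [← integral_pow_eq_tsum hm hz, integral_pow_comp_eq_laplace hN hT hNT t hz0.le hz1.le,
      hbμ.laplace t _ hl, show laplaceExponent b μ (q * (1 - z)) =
      q * (1 - (b * z + ∑' m, (jumpWeight μ q m).toReal * z ^ (m + 1))) by linarith]
    push_cast
    rfl

/-- If `N` is independent of `(T, Z)` and `Z` of `T`, then `Z` is independent of the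
finite-dimensional marginals of `N ∘ T`. -/
lemma indepFun_comp_subordinator {E : Type*} [MeasurableSpace E] {Z : ℕ → Ω → E}
    (hZ : ∀ n, AEMeasurable (Z n) P) (hN : IsLevyProcess (fun t ω ↦ (N t ω : ℝ)) P)
    (hT : IsSubordinator T P) (hZT : IndepFun (fun ω n ↦ Z n ω) (fun ω t ↦ T t ω) P)
    (hNTZ : IndepFun (fun ω t ↦ N t ω) (fun ω ↦ (fun t ↦ T t ω, fun n ↦ Z n ω)) P)
    {ι : Type*} [Countable ι] (t : ι → ℝ≥0) :
    IndepFun (fun ω n ↦ Z n ω) (fun ω i ↦ N (T (t i) ω) ω) P := by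
  have hZm : AEMeasurable (fun ω n ↦ Z n ω) P := aemeasurable_pi_lambda _ hZ
  have hTm : AEMeasurable (fun ω i ↦ T (t i) ω) P :=
    aemeasurable_pi_lambda _ fun i ↦ aemeasurable_of_nnrealCoe (hT.levy.aemeasurable _)
  have hTr : Measurable fun (c : ℝ≥0 → ℝ≥0) (i : ι) ↦ c (t i) := by fun_prop
  have hNTZ' : IndepFun (fun ω (p : ℕ × ℕ) ↦ (N (p.2 / (p.1 + 1)) ω : ℝ))
      (fun ω ↦ ((fun i ↦ T (t i) ω), fun n ↦ Z n ω)) P :=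
    hNTZ.comp measurable_grid (hTr.prodMap measurable_id)
  have hTZ : IndepFun (fun ω i ↦ T (t i) ω) (fun ω n ↦ Z n ω) P :=
    hZT.symm.comp hTr measurable_id
  have h := IndepFun.prodMk_left_of_prodMk_right (aemeasurable_grid hN) hTm hZm hNTZ' hTZ
  have hpr (i : ι) : Measurable fun p : (ℕ × ℕ → ℝ) × (ι → ℝ≥0) ↦ (p.1, p.2 i) := by fun_prop
  have hfloor (i : ι) := measurable_floor_evalGrid.comp (hpr i)
  -- The sampled clock is almost surely a measurable function of the grid values of `N` and of the
  -- sampled `T`.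
  have hG : Measurable fun (p : (ℕ × ℕ → ℝ) × (ι → ℝ≥0)) i ↦ ⌊evalGrid p.1 (p.2 i)⌋₊ :=
    measurable_pi_iff.2 hfloor
  have hG' : (fun p : (ℕ × ℕ → ℝ) × (ι → ℝ≥0) ↦ fun i ↦ ⌊evalGrid p.1 (p.2 i)⌋₊) ∘
      (fun ω ↦ ((fun p : ℕ × ℕ ↦ (N (p.2 / (p.1 + 1)) ω : ℝ)), fun i ↦ T (t i) ω)) =ᵐ[P]
      fun ω i ↦ N (T (t i) ω) ω := by
    filter_upwards [ae_natCast_eq_evalGrid hN] with ω hω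
    ext i
    exact (hω (T (t i) ω)).symm
  exact (h.symm.comp measurable_id hG).congr .rfl hG'

end PoissonSubordination

/-! ### The step law of the discrete subordinate walk -/

section StepLaw

variable {Ω : Type*} {mΩ : MeasurableSpace Ω} {P : Measure Ω} [IsProbabilityMeasure P]

/-- The characteristic function of the step law of the discrete subordinate random walk. -/
lemma charFun_discreteSubordinationLaw {E : Type*} [NormedAddCommGroup E] [InnerProductSpace ℝ E]
    [MeasurableSpace E] [BorelSpace E] [SecondCountableTopology E] {Z : ℕ → Ω → E} {ρ : Measure E}
    (hZ : IsRandomWalkWithStepLaw Z ρ P) {b : ℝ} (hb : 0 ≤ b) {μ : Measure ℝ} {q : ℝ}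
    (h : IsFiniteMeasure (discreteSubordinationLaw Z P b μ q)) (θ : E) :
    charFun (discreteSubordinationLaw Z P b μ q) θ = b * charFun ρ θ +
      ∑' m, ((jumpWeight μ q m).toReal : ℂ) * charFun ρ θ ^ (m + 1) := by
  have (m : ℕ) : IsProbabilityMeasure (P.map (Z (m + 1))) :=
    Measure.isProbabilityMeasure_map (hZ.aemeasurable _)
  have h' := charFun_smul_add_sum_smul (ρ₀ := P.map (Z 1)) (ρ := fun m ↦ P.map (Z (m + 1)))
    (c := jumpWeight μ q) hb h θ
  simp only [hZ.charFun_eq, pow_one] at h'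
  exact h'

lemma tsum_jumpWeight_ne_top {E : Type*} [MeasurableSpace E] {Z : ℕ → Ω → E}
    (hZ : ∀ n, AEMeasurable (Z n) P) {b : ℝ} {μ : Measure ℝ} {q : ℝ}
    (h : IsFiniteMeasure (discreteSubordinationLaw Z P b μ q)) : ∑' m, jumpWeight μ q m ≠ ∞ :=
  have (m : ℕ) : IsProbabilityMeasure (P.map (Z (m + 1))) :=
    Measure.isProbabilityMeasure_map (hZ _)
  tsum_ne_top_of_isFiniteMeasure (ρ := fun m ↦ P.map (Z (m + 1))) h

end StepLaw

end SubordinateRW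

theorem proposition1 {Ω : Type*} [MeasurableSpace Ω] (P : Measure Ω) [IsProbabilityMeasure P]
    (d : ℕ)
    (Z : ℕ → Ω → EuclideanSpace ℝ (Fin d)) (hZ : IsRandomWalk Z P)
    (T : ℝ≥0 → Ω → ℝ≥0) (hT : IsSubordinator T P)
    (hTnonconst : ¬ ∀ᵐ ω ∂P, ∀ t, T t ω = 0)
    (hZT : IndepFun (fun ω n ↦ Z n ω) (fun ω t ↦ T t ω) P)
    (b : ℝ) (μ : Measure ℝ) (hbμ : HasDriftAndLevyMeasure T P b μ)
    (q : ℝ≥0) (hq : 0 < q) (hφ : laplaceExponent b μ (q : ℝ) = (q : ℝ))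
    (X : ℕ → Ω → EuclideanSpace ℝ (Fin d))
    (hX : IsRandomWalkWithStepLaw X (discreteSubordinationLaw Z P b μ q) P)
    (N : ℝ≥0 → Ω → ℕ) (hN : IsPoissonProcess N q P)
    (hNX : IndepFun (fun ω t ↦ N t ω) (fun ω n ↦ X n ω) P)
    (hNTZ : IndepFun (fun ω t ↦ N t ω) (fun ω ↦ (fun t ↦ T t ω, fun n ↦ Z n ω)) P) :
    IsCompoundPoissonProcess (fun t ω ↦ X (N t ω) ω) P ∧
    IsCompoundPoissonProcess (fun t ω ↦ Z (N (T t ω) ω) ω) P ∧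
    (∃ (β : EuclideanSpace ℝ (Fin d)) (Q : Matrix (Fin d) (Fin d) ℝ)
        (ν : Measure (EuclideanSpace ℝ (Fin d))),
      HasLevyTriplet (fun t ω ↦ X (N t ω) ω) P β Q ν ∧
      HasLevyTriplet (fun t ω ↦ Z (N (T t ω) ω) ω) P β Q ν) ∧
    (∀ I : Finset ℝ≥0,
      P.map (fun ω ↦ I.restrict (fun t ↦ X (N t ω) ω)) =
        P.map (fun ω ↦ I.restrict (fun t ↦ Z (N (T t ω) ω) ω))) := by
  obtain ⟨ρ, hZ⟩ := hZ
  set ξ := discreteSubordinationLaw Z P b μ q with hξ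
  -- That `X` has steps of law `ξ` forces total mass one, and hence summable jump weights.
  have hξp : IsProbabilityMeasure ξ := by
    obtain ⟨x, -, hx, -⟩ := hX
    exact (hx 0).isProbabilityMeasure_iff.1 inferInstance
  have hρp : IsProbabilityMeasure ρ := by
    obtain ⟨x, -, hx, -⟩ := hZ
    exact (hx 0).isProbabilityMeasure_iff.1 inferInstance
  have hw : ∑' m, jumpWeight μ q m ≠ ∞ :=
    tsum_jumpWeight_ne_top hZ.aemeasurable (b := b) (hξ ▸ inferInstance)
  have hNT : IndepFun (fun ω t ↦ N t ω) (fun ω t ↦ T t ω) P :=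
    hNTZ.comp measurable_id measurable_fst
  have hM : IsLevyProcess (fun t ω ↦ (N (T t ω) ω : ℝ)) P :=
    hN.levy.comp_subordinator hT (hNT.comp
      (by fun_prop : Measurable fun (y : ℝ≥0 → ℕ) s ↦ (y s : ℝ)) measurable_id)
  have hXN (n : ℕ) (t : Fin n → ℝ≥0) :
      IndepFun (fun ω n ↦ X n ω) (fun ω i ↦ N (t i) ω) P :=
    hNX.symm.comp measurable_id (by fun_prop : Measurable fun (y : ℝ≥0 → ℕ) i ↦ y (t i))
  have hXhat : IsLevyProcess (fun t ω ↦ X (N t ω) ω) P := hX.isLevyProcess_comp hN.levy hXN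
  have hZtilde : IsLevyProcess (fun t ω ↦ Z (N (T t ω) ω) ω) P :=
    hZ.isLevyProcess_comp hM fun n t ↦
      indepFun_comp_subordinator hZ.aemeasurable hN.levy hT hZT hNTZ t
  have hXexp : HasCharExponent (fun t ω ↦ X (N t ω) ω) P fun θ ↦ q * (1 - charFun ξ θ) := by
    intro t θ
    have hind : IndepFun (fun ω n ↦ X n ω) (N t) P :=
      hNX.symm.comp measurable_id (measurable_pi_apply t)
    rw [hX.charFun_comp (hN.law t).aemeasurable hind,
      integral_pow_of_hasLaw_poissonMeasure (hN.law t)]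
    push_cast
    ring_nf
  have hZexp : HasCharExponent (fun t ω ↦ Z (N (T t ω) ω) ω) P
      fun θ ↦ q * (1 - charFun ξ θ) := by
    intro t θ
    have hind : IndepFun (fun ω n ↦ Z n ω) (fun ω ↦ N (T t ω) ω) P :=
      (indepFun_comp_subordinator hZ.aemeasurable hN.levy hT hZT hNTZ
        fun _ : Unit ↦ t).comp measurable_id (measurable_pi_apply ())
    -- The generating function is taken at $w=\hat\rho(\theta)$, where its exponent becomes
    -- $q(1-\hat\xi(\theta))$.
    rw [hZ.charFun_comp (aemeasurable_of_natCast (hM.aemeasurable t)) hind,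
      integral_pow_comp hN hT hNT hbμ hq hφ hw t
        (norm_charFun_le_one θ),
      hξ, ← charFun_discreteSubordinationLaw hZ hbμ.drift_nonneg (hξ ▸ inferInstance)]
  refine ⟨isCompoundPoissonProcess_of_hasCharExponent hXhat (NNReal.coe_pos.2 hq) hXexp,
    isCompoundPoissonProcess_of_hasCharExponent hZtilde (NNReal.coe_pos.2 hq) hZexp,
    ⟨_, _, _, hasLevyTriplet_of_hasCharExponent hXhat hXexp,
      hasLevyTriplet_of_hasCharExponent hZtilde hZexp⟩,
    hXhat.map_restrict_eq hZtilde fun t ↦ ?_⟩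
  have := Measure.isProbabilityMeasure_map (hXhat.aemeasurable t)
  have := Measure.isProbabilityMeasure_map (hZtilde.aemeasurable t)
  exact Measure.ext_of_charFun (funext fun θ ↦ (hXexp t θ).trans (hZexp t θ).symm)
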